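/- Let $(M,g)$ be a smooth $n$-dimensional Riemannian manifold, and let $T^*_0M$ be its cotangent bundle without the zero section, with the local coordinates $(q^i,p_i)$ induced from local charts $(x^i)$ of $M$ (a covector at the point with coordinates $q^i$ is $p_i\,dx^i$). Write $g_{ij}$ for the components of $g$, $(g^{ij})$ for the inverse matrix, $\Gamma^k_{ij}$ for the Christoffel symbols of $g$, $g^{0i}=p_hg^{hi}$, $t=\frac12 g^{ik}p_ip_k$, and $$\frac{\delta}{\delta q^i}=\frac{\partial}{\partial q^i}+p_k\Gamma^k_{ih}\frac{\partial}{\partial p_h}.$$ Let $a_1,a_2,b_1,b_2:(0,\infty)\to\mathbb R$ be smooth, and let $J$ be the field of endomorphisms of the tangent spaces of $T^*_0M$ given by $$J\frac{\delta}{\delta q^i}=\big(a_1(t)g_{ij}+b_1(t)p_ip_j\big)\frac{\partial}{\partial p_j},\qquad J\frac{\partial}{\partial p_i}=-\big(a_2(t)g^{ij}+b_2(t)g^{0i}g^{0j}\big)\frac{\delta}{\delta q^j}.$$ Assume that $J$ is an almost complex structure, i.e. $J^2=-I$, that $a_1(t)=A\sqrt t$ for all $t>0$ with a real constant $A>0$,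 and that $A+2\sqrt t\,b_1(t)>0$ for all $t>0$. Then $J$ is integrable, i.e. its Nijenhuis tensor $N(X,Y)=[JX,JY]-J[JX,Y]-J[X,JY]-[X,Y]$ vanishes on $T^*_0M$, if and only if $(M,g)$ has constant sectional curvature $c$ for some real number $c>0$ with $A=\sqrt{2c}$. (For $n\le 1$ the condition on the sectional curvature is vacuous.) In that case $b_1$ satisfies $b_1(t)>-\sqrt{c/(2t)}$ for all $t>0$. -/

import Mathlib

open scoped Manifold ContDiff

noncomputable section

namespace CotangentACS

/-- The coordinate space `ℝⁿ`. -/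
abbrev Coord (n : ℕ) : Type := EuclideanSpace ℝ (Fin n)

/-- The range space `ℝⁿ × ℝⁿ` of the induced charts `(q¹, …, qⁿ, p₁, …, pₙ)` of the cotangent
bundle; also the space of component vectors with respect to `∂/∂qⁱ`, `∂/∂pᵢ`. -/
abbrev Phase (n : ℕ) : Type := Coord n × Coord n

/-- The `i`-th standard basis vector of `ℝⁿ`. -/
abbrev stdVec {n : ℕ} (i : Fin n) : Coord n := EuclideanSpace.single i (1 : ℝ)

/-- The partial derivative `∂f/∂xⁱ` at `q`. -/
def partialDeriv {n : ℕ} (i : Fin n) (f : Coord n → ℝ) (q : Coord n) : ℝ :=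
  fderiv ℝ f q (stdVec i)

/-! ### Coordinate objects attached to a field of matrices `(g_ij)` on `ℝⁿ` -/

section Coordinates

variable {n : ℕ} (G : Coord n → Matrix (Fin n) (Fin n) ℝ)

/-- The Christoffel symbols
`Γᵏᵢⱼ = ½ gᵏˡ (∂ᵢ g_lj + ∂ⱼ g_li - ∂ₗ g_ij)`. -/
def christoffel (k i j : Fin n) (q : Coord n) : ℝ :=
  (1 / 2) * ∑ l, (G q)⁻¹ k l *
    (partialDeriv i (fun y => G y l j) q + partialDeriv j (fun y => G y l i) q
      - partialDeriv l (fun y => G y i j) q)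

/-- The components `Rʰₖᵢⱼ` of the curvature tensor, `R(∂ᵢ, ∂ⱼ) ∂ₖ = Rʰₖᵢⱼ ∂ₕ`, where
`R(X, Y) Z = ∇_X ∇_Y Z - ∇_Y ∇_X Z - ∇_[X, Y] Z`. -/
def curvature (h k i j : Fin n) (q : Coord n) : ℝ :=
  partialDeriv i (christoffel G h j k) q - partialDeriv j (christoffel G h i k) q
    + ∑ l, (christoffel G h i l q * christoffel G l j k q
      - christoffel G h j l q * christoffel G l i k q)

/-- The scalar product `g_ij uⁱ vʲ`. -/
def metricForm (q u v : Coord n) : ℝ := ∑ i, ∑ j, G q i j * u i * v j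

/-- The sectional curvature `g(R(u, v) v, u) / (g(u, u) g(v, v) - g(u, v)²)` of the plane spanned
by the linearly independent vectors `u`, `v`. -/
def sectionalCurvature (q u v : Coord n) : ℝ :=
  (∑ m, ∑ h, ∑ k, ∑ i, ∑ j, G q m h * curvature G h k i j q * u m * v k * u i * v j) /
    (metricForm G q u u * metricForm G q v v - metricForm G q u v ^ 2)

/-- The energy density `t = ½ gⁱᵏ pᵢ pₖ` of a covector. -/
def energy (z : Phase n) : ℝ := (1 / 2) * ∑ i, ∑ k, (G z.1)⁻¹ i k * z.2 i * z.2 k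

/-- The components `g⁰ⁱ = pₕ gʰⁱ`. -/
def raised (z : Phase n) (i : Fin n) : ℝ := ∑ h, z.2 h * (G z.1)⁻¹ h i

/-- The components `Γ⁰ᵢₕ = pₖ Γᵏᵢₕ`. -/
def christoffelZero (z : Phase n) (i h : Fin n) : ℝ := ∑ k, z.2 k * christoffel G k i h z.1

/-- The vertical frame vector `∂/∂pᵢ`. -/
def vertVec (i : Fin n) : Phase n := (0, stdVec i)

/-- The horizontal frame vector `δ/δqⁱ = ∂/∂qⁱ + Γ⁰ᵢₕ ∂/∂pₕ` at `z = (q, p)`. -/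
def horVec (z : Phase n) (i : Fin n) : Phase n :=
  (stdVec i, 0) + ∑ h, christoffelZero G z i h • vertVec h

/-- The components `J⁽¹⁾ᵢⱼ = a₁(t) g_ij + b₁(t) pᵢ pⱼ`. -/
def J1 (a₁ b₁ : ℝ → ℝ) (z : Phase n) (i j : Fin n) : ℝ :=
  a₁ (energy G z) * G z.1 i j + b₁ (energy G z) * z.2 i * z.2 j

/-- The components `J₍₂₎ⁱʲ = a₂(t) gⁱʲ + b₂(t) g⁰ⁱ g⁰ʲ`. -/
def J2 (a₂ b₂ : ℝ → ℝ) (z : Phase n) (i j : Fin n) : ℝ :=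
  a₂ (energy G z) * (G z.1)⁻¹ i j + b₂ (energy G z) * raised G z i * raised G z j

/-- The horizontal components `Xⁱ` in the expansion
`X = Xⁱ δ/δqⁱ + Yₕ ∂/∂pₕ` of a tangent vector at `z`. -/
def horComp (X : Phase n) (i : Fin n) : ℝ := X.1 i

/-- The vertical components `Yₕ` in the expansion
`X = Xⁱ δ/δqⁱ + Yₕ ∂/∂pₕ` of a tangent vector at `z`. -/
def vertComp (z X : Phase n) (h : Fin n) : ℝ := X.2 h - ∑ i, X.1 i * christoffelZero G z i h

/-- The operator `J` at `z`: the linear operator with `J δ/δqⁱ = J⁽¹⁾ᵢⱼ ∂/∂pⱼ` and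
`J ∂/∂pᵢ = -J₍₂₎ⁱʲ δ/δqʲ` (see `adapted_expansion`, `diagJ_horVec`, `diagJ_vertVec`). -/
def diagJ (a₁ a₂ b₁ b₂ : ℝ → ℝ) (z X : Phase n) : Phase n :=
  (∑ i, ∑ j, (horComp X i * J1 G a₁ b₁ z i j) • vertVec j)
    - ∑ i, ∑ j, (vertComp G z X i * J2 G a₂ b₂ z i j) • horVec G z j

theorem horComp_vertVec (i j : Fin n) : horComp (vertVec i) j = 0 := by
  simp [horComp, vertVec]

theorem vertComp_vertVec (z : Phase n) (i j : Fin n) :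
    vertComp G z (vertVec i) j = if j = i then 1 else 0 := by
  simp [vertComp, vertVec]

theorem horVec_fst (z : Phase n) (i : Fin n) : (horVec G z i).1 = stdVec i := by
  simp [horVec, vertVec, Prod.fst_sum]

theorem horVec_snd (z : Phase n) (i h : Fin n) :
    (horVec G z i).2 h = christoffelZero G z i h := by
  simp [horVec, vertVec, Prod.snd_sum, Pi.single_apply]

theorem horComp_horVec (z : Phase n) (i j : Fin n) :
    horComp (horVec G z i) j = if j = i then 1 else 0 := by
  simp [horComp, horVec_fst]

theorem vertComp_horVec (z : Phase n) (i j : Fin n) : vertComp G z (horVec G z i) j = 0 := by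
  simp [vertComp, horVec_fst, horVec_snd]

theorem adapted_expansion (z X : Phase n) :
    X = ∑ i, horComp X i • horVec G z i + ∑ h, vertComp G z X h • vertVec h := by
  refine Prod.ext ?_ ?_
  · ext j
    simp [Prod.fst_sum, horVec_fst, horComp, vertVec, Pi.single_apply]
  · ext j
    simp [Prod.snd_sum, horVec_snd, horComp, vertComp, vertVec, Pi.single_apply]

theorem diagJ_horVec (a₁ a₂ b₁ b₂ : ℝ → ℝ) (z : Phase n) (i : Fin n) :
    diagJ G a₁ a₂ b₁ b₂ z (horVec G z i) = ∑ j, J1 G a₁ b₁ z i j • vertVec j := by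
  simp [diagJ, horComp_horVec, vertComp_horVec]

theorem diagJ_vertVec (a₁ a₂ b₁ b₂ : ℝ → ℝ) (z : Phase n) (i : Fin n) :
    diagJ G a₁ a₂ b₁ b₂ z (vertVec i) = -∑ j, J2 G a₂ b₂ z i j • horVec G z j := by
  simp [diagJ, horComp_vertVec, vertComp_vertVec]

end Coordinates

/-- The Nijenhuis tensor `N(X, Y) = [JX, JY] - J[JX, Y] - J[X, JY] - [X, Y]` of a field of
operators `J`. -/
def nijenhuis {n : ℕ} (J : Phase n → Phase n → Phase n) (X Y : Phase n → Phase n)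
    (z : Phase n) : Phase n :=
  VectorField.lieBracket ℝ (fun w => J w (X w)) (fun w => J w (Y w)) z
    - J z (VectorField.lieBracket ℝ (fun w => J w (X w)) Y z)
    - J z (VectorField.lieBracket ℝ X (fun w => J w (Y w)) z)
    - VectorField.lieBracket ℝ X Y z

/-! ### Riemannian manifolds and their nonzero cotangent bundles -/

section Manifold

variable {n : ℕ} {M : Type*} [TopologicalSpace M] [ChartedSpace (Coord n) M]

/-- A point of the nonzero cotangent bundle `T*₀M`: a point of `M` with a nonzero covector. -/
structure NonzeroCotangent (n : ℕ) (M : Type*) [TopologicalSpace M]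
    [ChartedSpace (Coord n) M] where
  base : M
  covector : TangentSpace (𝓡 n) base →L[ℝ] ℝ
  ne_zero : covector ≠ 0

/-- The coordinate vector `∂/∂xⁱ` of the chart `φ` at the point with coordinates `q`. -/
def coordVec (φ : OpenPartialHomeomorph M (Coord n)) (q : Coord n) (i : Fin n) :
    TangentSpace (𝓡 n) (φ.symm q) :=
  mfderiv (𝓡 n) (𝓡 n) φ.symm q (stdVec i)

/-- The chart of `T*₀M` induced by the chart `φ` of `M`: a covector `p` at `x` goes to
`(q, p₁, …, pₙ)`, where `q = φ x` and `pᵢ = p (∂/∂xⁱ)`. -/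
def inducedChart (φ : OpenPartialHomeomorph M (Coord n)) (p : NonzeroCotangent n M) : Phase n :=
  (φ p.base, WithLp.toLp 2 fun i =>
    p.covector (mfderiv (𝓡 n) (𝓡 n) φ.symm (φ p.base) (stdVec i)))

/-- The range of the induced chart: the part of `ℝⁿ × ℝⁿ` over `φ`, without the zero section. -/
def inducedTarget (φ : OpenPartialHomeomorph M (Coord n)) : Set (Phase n) :=
  {z | z.1 ∈ φ.target ∧ z.2 ≠ 0}

variable [IsManifold (𝓡 n) ∞ M]
  (g : Bundle.ContMDiffRiemannianMetric (𝓡 n) ∞ (Coord n) fun x : M => TangentSpace (𝓡 n) x)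

/-- The components `g_ij` of the metric in the chart `φ`. -/
def metricMatrix (φ : OpenPartialHomeomorph M (Coord n)) (q : Coord n) :
    Matrix (Fin n) (Fin n) ℝ :=
  Matrix.of fun i j => g.inner (φ.symm q) (coordVec φ q i) (coordVec φ q j)

/-- `(M, g)` has constant sectional curvature `c`. -/
def HasConstantSectionalCurvature (c : ℝ) : Prop :=
  ∀ φ ∈ IsManifold.maximalAtlas (𝓡 n) ∞ M, ∀ q ∈ φ.target, ∀ u v : Coord n,
    LinearIndependent ℝ ![u, v] → sectionalCurvature (metricMatrix g φ) q u v = c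

/-- The natural operator `J` of diagonal type on `T*₀M` with parameters `a₁, a₂, b₁, b₂`, in the
chart of `T*₀M` induced by `φ`. -/
def naturalJ (a₁ a₂ b₁ b₂ : ℝ → ℝ) (φ : OpenPartialHomeomorph M (Coord n)) :
    Phase n → Phase n → Phase n :=
  diagJ (metricMatrix g φ) a₁ a₂ b₁ b₂

/-- `J` is an almost complex structure on `T*₀M`: `J² = -I`. -/
def IsAlmostComplex (a₁ a₂ b₁ b₂ : ℝ → ℝ) : Prop :=
  ∀ φ ∈ IsManifold.maximalAtlas (𝓡 n) ∞ M,
    ∀ p : NonzeroCotangent n M, p.base ∈ φ.source → ∀ X : Phase n,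
      naturalJ g a₁ a₂ b₁ b₂ φ (inducedChart φ p)
        (naturalJ g a₁ a₂ b₁ b₂ φ (inducedChart φ p) X) = -X

/-- `J` is integrable on `T*₀M`: its Nijenhuis tensor vanishes at every point of `T*₀M`, on all
smooth vector fields of every induced chart. -/
def IsIntegrable (a₁ a₂ b₁ b₂ : ℝ → ℝ) : Prop :=
  ∀ φ ∈ IsManifold.maximalAtlas (𝓡 n) ∞ M,
    ∀ X Y : Phase n → Phase n,
      ContDiffOn ℝ ∞ X (inducedTarget φ) → ContDiffOn ℝ ∞ Y (inducedTarget φ) →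
        ∀ p : NonzeroCotangent n M, p.base ∈ φ.source →
          nijenhuis (naturalJ g a₁ a₂ b₁ b₂ φ) X Y (inducedChart φ p) = 0

end Manifold

end CotangentACS

end

open scoped Manifold ContDiff

namespace CotangentACS

/-! ### Induced charts of the nonzero cotangent bundle and the metric in coordinates. -/

section Charts

variable {n : ℕ} {M : Type*} [TopologicalSpace M] [ChartedSpace (Coord n) M]

/-! The question is local. A chart turns `g` into a smooth field of positive definite matrices, and
the induced chart maps the part of `T*₀M` over it onto the phase space with nonzero momenta. Because
`J² = -1`, the Nijenhuis tensor is tensorial and satisfies `N(Jx, y) = -J N(x, y)`. The horizontal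
vectors `δᵢ = δ/δqⁱ` and their images `J δᵢ` span, so only `N(δᵢ, δⱼ)` matters
(`nijenhuisTensor_eq_zero_of_span`).

Three bracket computations give `N(δᵢ, δⱼ)`. First, `[δᵢ, δⱼ] = pₖ Rᵏ_bij ∂/∂p_b`
(`lieBracket_horVec`). Next, `[Jδᵢ, δⱼ] + [δᵢ, Jδⱼ] = 0`, because `g` and `t` are constant along
horizontal directions and the connection has no torsion (`lieBracket_rowJ1_horVec`). Finally, `[Jδᵢ,
Jδⱼ]` has components `(a₁a₁' + (2t a₁' - a₁) b₁)(pᵢ g_jb - pⱼ g_ib)`. For `a₁ = A√t` one has `2t a₁'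
= a₁` and `a₁a₁' = A²/2`, so `b₁` drops out (`lieBracket_rowJ1`).

Hence `N = 0` exactly when `pₖ Rᵏ_bij = (A²/2)(pᵢ g_jb - pⱼ g_ib)` for all `p ≠ 0`. This says that
the curvature tensor is that of constant curvature `c = A²/2`, equivalently that all sectional
curvatures equal `c` (`sectionalCurvature_eq_iff`, `loweredCurvature_eq_iff`). -/

theorem mdifferentiable_of_mem_maximalAtlas {φ : OpenPartialHomeomorph M (Coord n)}
    (hφ : φ ∈ IsManifold.maximalAtlas (𝓡 n) ∞ M) : φ.MDifferentiable (𝓡 n) (𝓡 n) :=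
  ⟨(contMDiffOn_of_mem_maximalAtlas hφ).mdifferentiableOn (by simp),
    (contMDiffOn_symm_of_mem_maximalAtlas hφ).mdifferentiableOn (by simp)⟩

/-- A vector of `ℝⁿ`, expanded in the standard basis. -/
theorem sum_smul_stdVec (v : Coord n) : ∑ i, v i • stdVec i = v := by
  ext j
  simp [Pi.single_apply]

/-- The differentials of the chart and of its inverse compose to the identity, so the coordinate
vectors span the tangent space and a covector with zero components vanishes. -/
theorem inducedChart_mem_inducedTarget {φ : OpenPartialHomeomorph M (Coord n)}
    (hφ : φ ∈ IsManifold.maximalAtlas (𝓡 n) ∞ M) (p : NonzeroCotangent n M)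
    (hp : p.base ∈ φ.source) : inducedChart φ p ∈ inducedTarget φ := by
  refine ⟨φ.map_source hp, fun h0 => p.ne_zero ?_⟩
  have hd := mdifferentiable_of_mem_maximalAtlas hφ
  have hi (i : Fin n) :
      p.covector (mfderiv (𝓡 n) (𝓡 n) φ.symm (φ p.base) (stdVec i)) = 0 :=
    congrArg (fun v : Coord n => v i) h0
  have hcomp (v : Coord n) :
      p.covector (mfderiv (𝓡 n) (𝓡 n) φ.symm (φ p.base) v) = 0 := by
    rw [← sum_smul_stdVec v]
    erw [map_sum, map_sum]
    refine Finset.sum_eq_zero fun i _ => ?_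
    erw [map_smul, map_smul, hi i]
    simp
  ext v
  have hv := DFunLike.congr_fun (hd.symm_comp_deriv hp) v
  simp only [ContinuousLinearMap.comp_apply] at hv
  exact (congrArg p.covector hv).symm.trans (hcomp _)

theorem exists_inducedChart_eq {φ : OpenPartialHomeomorph M (Coord n)}
    (hφ : φ ∈ IsManifold.maximalAtlas (𝓡 n) ∞ M) {z : Phase n} (hz : z ∈ inducedTarget φ) :
    ∃ p : NonzeroCotangent n M, p.base ∈ φ.source ∧ inducedChart φ p = z := by
  have hd := mdifferentiable_of_mem_maximalAtlas hφ
  obtain ⟨q, p⟩ := z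
  obtain ⟨hq, hp⟩ : q ∈ φ.target ∧ p ≠ 0 := hz
  have hcomp (i : Fin n) :
      innerSL ℝ p (mfderiv (𝓡 n) (𝓡 n) φ (φ.symm q)
        (mfderiv (𝓡 n) (𝓡 n) φ.symm q (stdVec i)) : Coord n) = p i := by
    have hv := DFunLike.congr_fun (hd.comp_symm_deriv hq) (stdVec i : Coord n)
    refine (congrArg (innerSL ℝ p) hv).trans ?_
    refine (innerSL_apply_apply ..).trans ?_
    exact (EuclideanSpace.inner_single_right i (1 : ℝ) p).trans (by simp)
  -- The Euclidean inner product with `p` is the functional `v ↦ pᵢ vⁱ`; its pullback by the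
  -- differential of `φ` has components `pᵢ`.
  let η : TangentSpace (𝓡 n) (φ.symm q) →L[ℝ] ℝ :=
    (innerSL ℝ p).comp (mfderiv (𝓡 n) (𝓡 n) φ (φ.symm q))
  have hη : η ≠ 0 := by
    intro h
    refine hp ?_
    ext i
    rw [← hcomp i]
    exact DFunLike.congr_fun h _
  refine ⟨⟨φ.symm q, η, hη⟩, φ.map_target hq, ?_⟩
  refine Prod.ext (φ.right_inv hq) ?_
  ext i
  simp only [inducedChart]
  rw [φ.right_inv hq]
  exact hcomp i

variable [IsManifold (𝓡 n) ∞ M]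

/-- The coordinate field is the tangent map of `φ.symm` applied to a constant section. -/
theorem contMDiffOn_coordVec {φ : OpenPartialHomeomorph M (Coord n)}
    (hφ : φ ∈ IsManifold.maximalAtlas (𝓡 n) ∞ M) (i : Fin n) :
    ContMDiffOn (𝓡 n) (𝓡 n).tangent ∞
      (fun q => (⟨φ.symm q, coordVec φ q i⟩ : TangentBundle (𝓡 n) M)) φ.target := by
  have h1 := (contMDiffOn_symm_of_mem_maximalAtlas hφ).contMDiffOn_tangentMapWithin
    (m := ∞) (by simp) φ.open_target.uniqueMDiffOn
  have h2 : ContMDiffOn (𝓡 n) (𝓡 n).tangent ∞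
      (fun q : Coord n => (⟨q, stdVec i⟩ : TangentBundle (𝓡 n) (Coord n))) φ.target :=
    contMDiffOn_vectorSpace_iff_contDiffOn.2 contDiffOn_const
  refine (h1.comp h2 fun q hq => hq).congr fun q hq => ?_
  simp only [Function.comp_apply, tangentMapWithin, coordVec]
  rw [mfderivWithin_of_isOpen φ.open_target hq]

variable
  (g : Bundle.ContMDiffRiemannianMetric (𝓡 n) ∞ (Coord n) fun x : M => TangentSpace (𝓡 n) x)

theorem contDiffOn_metricMatrix {φ : OpenPartialHomeomorph M (Coord n)}
    (hφ : φ ∈ IsManifold.maximalAtlas (𝓡 n) ∞ M) (i j : Fin n) :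
    ContDiffOn ℝ ∞ (fun q => metricMatrix g φ q i j) φ.target := by
  have h := ContMDiffOn.clm_bundle_apply₂ (E₃ := Bundle.Trivial M ℝ)
    (g.contMDiff.comp_contMDiffOn (contMDiffOn_symm_of_mem_maximalAtlas hφ))
    (contMDiffOn_coordVec hφ i) (contMDiffOn_coordVec hφ j)
  refine contMDiffOn_iff_contDiffOn.1 fun q hq => ?_
  exact ((Bundle.contMDiffWithinAt_totalSpace).1 (h q hq)).2

theorem posDef_metricMatrix {φ : OpenPartialHomeomorph M (Coord n)}
    (hφ : φ ∈ IsManifold.maximalAtlas (𝓡 n) ∞ M) {q : Coord n} (hq : q ∈ φ.target) :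
    (metricMatrix g φ q).PosDef := by
  have hd := mdifferentiable_of_mem_maximalAtlas hφ
  refine Matrix.PosDef.of_dotProduct_mulVec_pos ?_ fun x hx => ?_
  · ext i j
    simp only [Matrix.conjTranspose_apply, metricMatrix, Matrix.of_apply, star_trivial]
    exact g.symm _ _ _
  -- The quadratic form of the matrix at `x` is `g(v, v)`, where `v` is the image of `x` under the
  -- injective differential of `φ.symm`.
  · set v : TangentSpace (𝓡 n) (φ.symm q) := ∑ i, x i • coordVec φ q i with hv
    have hvx : v = mfderiv (𝓡 n) (𝓡 n) φ.symm q (WithLp.toLp 2 x : Coord n) := by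
      rw [hv, ← sum_smul_stdVec (WithLp.toLp 2 x : Coord n)]
      erw [map_sum]
      refine Finset.sum_congr rfl fun i _ => ?_
      erw [map_smul]
      rfl
    have hv0 : v ≠ 0 := by
      rw [hvx]
      intro h0
      apply hx
      have := hd.symm.mfderiv_injective hq (h0.trans (map_zero _).symm)
      ext i
      exact congrArg (fun v : Coord n => v i) this
    have hpos := g.pos _ v hv0
    refine hpos.trans_eq ?_
    rw [hv]
    simp only [map_sum, map_smul, FunLike.coe_sum, FunLike.coe_smul, Finset.sum_apply,
      Pi.smul_apply, smul_eq_mul, dotProduct, Matrix.mulVec, metricMatrix, Matrix.of_apply,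
      star_trivial, Finset.mul_sum]
    refine Finset.sum_congr rfl fun i _ => Finset.sum_congr rfl fun j _ => ?_
    rw [g.symm]
    ring

end Charts

/-! ### Tensoriality of the Nijenhuis bracket and its behaviour under the operator. -/

section Tensor

variable {n : ℕ} {L : Phase n → Phase n →L[ℝ] Phase n} {z : Phase n}

/-- The value at `z` of the Nijenhuis tensor of a differentiable field `L` of linear operators with
`L² = -1`, as a bilinear map on tangent vectors. -/
noncomputable def nijenhuisTensor (L : Phase n → Phase n →L[ℝ] Phase n) (z : Phase n) :
    Phase n →ₗ[ℝ] Phase n →ₗ[ℝ] Phase n :=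
  LinearMap.mk₂ ℝ
    (fun x y => fderiv ℝ L z (L z x) y - fderiv ℝ L z (L z y) x
      + L z (fderiv ℝ L z y x - fderiv ℝ L z x y))
    (by intros; simp; abel) (by intros; simp [smul_sub, smul_add])
    (by intros; simp; abel) (by intros; simp [smul_sub, smul_add])

theorem nijenhuisTensor_apply (x y : Phase n) :
    nijenhuisTensor L z x y = fderiv ℝ L z (L z x) y - fderiv ℝ L z (L z y) x
      + L z (fderiv ℝ L z y x - fderiv ℝ L z x y) := rfl

theorem nijenhuisTensor_swap (x y : Phase n) :
    nijenhuisTensor L z x y = -nijenhuisTensor L z y x := by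
  simp only [nijenhuisTensor_apply, map_sub]
  abel

/-- By the product rule, the derivatives of `X` and `Y` enter in pairs that cancel because `L² =
-1`. -/
theorem nijenhuis_eq_nijenhuisTensor (hL : DifferentiableAt ℝ L z)
    (hsq : ∀ x, L z (L z x) = -x) {X Y : Phase n → Phase n}
    (hX : DifferentiableAt ℝ X z) (hY : DifferentiableAt ℝ Y z) :
    nijenhuis (fun w x => L w x) X Y z = nijenhuisTensor L z (X z) (Y z) := by
  have key {Z : Phase n → Phase n} (hZ : DifferentiableAt ℝ Z z) (v : Phase n) :
      fderiv ℝ (fun w => L w (Z w)) z v = fderiv ℝ L z v (Z z) + L z (fderiv ℝ Z z v) := by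
    rw [(hL.hasFDerivAt.clm_apply hZ.hasFDerivAt).fderiv]
    simp [add_comm]
  simp only [nijenhuis, VectorField.lieBracket, key hX, key hY, nijenhuisTensor_apply, map_sub,
    map_add, hsq]
  abel

theorem nijenhuisTensor_map_left (hL : DifferentiableAt ℝ L z)
    (hsq : ∀ᶠ w in nhds z, ∀ x, L w (L w x) = -x) (x y : Phase n) :
    nijenhuisTensor L z (L z x) y = -L z (nijenhuisTensor L z x y) := by
  have hz := hsq.self_of_nhds
  -- Differentiating `L² = -1`, which holds near `z`, shows that the derivative of `L` anticommutes
  -- with `L`.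
  have hd (v x : Phase n) : fderiv ℝ L z v (L z x) = -L z (fderiv ℝ L z v x) := by
    have h1 : HasFDerivAt (fun w => L w (L w x)) (0 : Phase n →L[ℝ] Phase n) z :=
      (hasFDerivAt_const (-x) z).congr_of_eventuallyEq (hsq.mono fun w hw => hw x)
    have h2 := hL.hasFDerivAt.clm_apply (hL.hasFDerivAt.clm_apply (hasFDerivAt_const x z))
    have h3 := DFunLike.congr_fun (h2.unique h1) v
    simp at h3
    rw [eq_neg_iff_add_eq_zero, add_comm]
    exact h3
  simp only [nijenhuisTensor_apply, map_sub, map_add, hd, hz, map_neg]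
  simp
  abel

/-- The Nijenhuis tensor vanishes as soon as it does on vectors that generate the tangent space
together with their images under `L`. -/
theorem nijenhuisTensor_eq_zero_of_span {ι : Type*} {h : ι → Phase n}
    (hL : DifferentiableAt ℝ L z) (hsq : ∀ᶠ w in nhds z, ∀ x, L w (L w x) = -x)
    (hspan : ∀ x, ∃ u ∈ Submodule.span ℝ (Set.range h), ∃ v ∈ Submodule.span ℝ (Set.range h),
      x = u + L z v)
    (hh : ∀ i j, nijenhuisTensor L z (h i) (h j) = 0) : nijenhuisTensor L z = 0 := by
  have h0 (u v : Phase n) (hu : u ∈ Submodule.span ℝ (Set.range h))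
      (hv : v ∈ Submodule.span ℝ (Set.range h)) : nijenhuisTensor L z u v = 0 := by
    induction hu, hv using Submodule.span_induction₂ with
    | mem_mem x y hx hy =>
      obtain ⟨i, rfl⟩ := hx
      obtain ⟨j, rfl⟩ := hy
      exact hh i j
    | zero_left y hy => simp
    | zero_right x hx => simp
    | add_left x y w _ _ _ h1 h2 => simp [h1, h2]
    | add_right x y w _ _ _ h1 h2 => simp [h1, h2]
    | smul_left r x y _ _ h1 => simp [h1]
    | smul_right r x y _ _ h1 => simp [h1]
  have hl (u v : Phase n) (hu : u ∈ Submodule.span ℝ (Set.range h))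
      (hv : v ∈ Submodule.span ℝ (Set.range h)) : nijenhuisTensor L z (L z u) v = 0 := by
    rw [nijenhuisTensor_map_left hL hsq, h0 u v hu hv, map_zero, neg_zero]
  have hr (u v : Phase n) (hu : u ∈ Submodule.span ℝ (Set.range h))
      (hv : v ∈ Submodule.span ℝ (Set.range h)) : nijenhuisTensor L z u (L z v) = 0 := by
    rw [nijenhuisTensor_swap, hl v u hv hu, neg_zero]
  refine LinearMap.ext₂ fun x y => ?_
  obtain ⟨u, hu, v, hv, rfl⟩ := hspan x
  obtain ⟨u', hu', v', hv', rfl⟩ := hspan y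
  simp only [map_add, LinearMap.add_apply, h0 u u' hu hu', hl v u' hv hu', hr u v' hu hv',
    nijenhuisTensor_map_left hL hsq v, hr v v' hv hv']
  simp

end Tensor

/-! ### Partial derivatives, the inverse metric and the Christoffel symbols. -/

section LocalGeometry

variable {n : ℕ} {G : Coord n → Matrix (Fin n) (Fin n) ℝ} {U : Set (Coord n)}

/-- A smooth field of positive definite matrices on an open subset of `ℝⁿ`. -/
structure IsSmoothMetricOn (G : Coord n → Matrix (Fin n) (Fin n) ℝ) (U : Set (Coord n)) :
    Prop where
  isOpen : IsOpen U
  contDiffOn (i j : Fin n) : ContDiffOn ℝ ∞ (fun q => G q i j) U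
  posDef {q : Coord n} (hq : q ∈ U) : (G q).PosDef

theorem contDiffOn_partialDeriv {f : Coord n → ℝ} (hU : IsOpen U) (hf : ContDiffOn ℝ ∞ f U)
    (i : Fin n) : ContDiffOn ℝ ∞ (partialDeriv i f) U :=
  (hf.fderiv_of_isOpen hU (by simp)).clm_apply contDiffOn_const

theorem partialDeriv_congr {f f' : Coord n → ℝ} (hU : IsOpen U) (h : Set.EqOn f f' U)
    {q : Coord n} (hq : q ∈ U) (i : Fin n) : partialDeriv i f q = partialDeriv i f' q := by
  unfold partialDeriv
  rw [(h.eventuallyEq_of_mem (hU.mem_nhds hq)).fderiv_eq]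

theorem partialDeriv_add {f f' : Coord n → ℝ} {q : Coord n} (hf : DifferentiableAt ℝ f q)
    (hf' : DifferentiableAt ℝ f' q) (i : Fin n) :
    partialDeriv i (fun y => f y + f' y) q = partialDeriv i f q + partialDeriv i f' q := by
  unfold partialDeriv
  rw [fderiv_fun_add hf hf']
  rfl

theorem partialDeriv_sum {ι : Type*} {s : Finset ι} {f : ι → Coord n → ℝ} {q : Coord n}
    (hf : ∀ k ∈ s, DifferentiableAt ℝ (f k) q) (i : Fin n) :
    partialDeriv i (fun y => ∑ k ∈ s, f k y) q = ∑ k ∈ s, partialDeriv i (f k) q := by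
  unfold partialDeriv
  rw [fderiv_fun_sum hf]
  simp

theorem partialDeriv_mul {f f' : Coord n → ℝ} {q : Coord n} (hf : DifferentiableAt ℝ f q)
    (hf' : DifferentiableAt ℝ f' q) (i : Fin n) :
    partialDeriv i (fun y => f y * f' y) q
      = f q * partialDeriv i f' q + partialDeriv i f q * f' q := by
  unfold partialDeriv
  rw [fderiv_fun_mul hf hf']
  simp [mul_comm]

theorem partialDeriv_comm {f : Coord n → ℝ} {q : Coord n} (hf : ContDiffAt ℝ ∞ f q)
    (i j : Fin n) :
    partialDeriv i (partialDeriv j f) q = partialDeriv j (partialDeriv i f) q := by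
  have hs : IsSymmSndFDerivAt ℝ f q := (hf.of_le (m := 2) (by norm_cast)).isSymmSndFDerivAt (by simp)
  have hd : DifferentiableAt ℝ (fderiv ℝ f) q :=
    (hf.fderiv_right (m := 1) (by norm_cast)).differentiableAt (by simp)
  have key (a b : Fin n) : partialDeriv a (partialDeriv b f) q
      = fderiv ℝ (fderiv ℝ f) q (stdVec a) (stdVec b) := by
    change fderiv ℝ (fun y => fderiv ℝ f y (stdVec b)) q (stdVec a) = _
    rw [(hd.hasFDerivAt.clm_apply (hasFDerivAt_const _ q)).fderiv]
    simp
  rw [key, key, hs]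

theorem contDiffOn_det {E : Type*} [NormedAddCommGroup E] [NormedSpace ℝ E] {S : Set E}
    {B : E → Matrix (Fin n) (Fin n) ℝ} (hB : ∀ i j, ContDiffOn ℝ ∞ (fun q => B q i j) S) :
    ContDiffOn ℝ ∞ (fun q => (B q).det) S := by
  simp only [Matrix.det_apply]
  exact ContDiffOn.sum fun σ _ => (contDiffOn_prod fun i _ => hB _ _).const_smul _

namespace IsSmoothMetricOn

theorem differentiableAt (hG : IsSmoothMetricOn G U) {q : Coord n} (hq : q ∈ U) (i j : Fin n) :
    DifferentiableAt ℝ (fun y => G y i j) q :=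
  ((hG.contDiffOn i j).contDiffAt (hG.isOpen.mem_nhds hq)).differentiableAt (by simp)

theorem symm (hG : IsSmoothMetricOn G U)
    {q : Coord n} (hq : q ∈ U) (i j : Fin n) : G q i j = G q j i := by
  simpa using (hG.posDef hq).1.apply j i

theorem isUnit_det (hG : IsSmoothMetricOn G U) {q : Coord n} (hq : q ∈ U) : IsUnit (G q).det :=
  (hG.posDef hq).det_pos.ne'.isUnit

theorem sum_mul_inv (hG : IsSmoothMetricOn G U) {q : Coord n} (hq : q ∈ U) (i j : Fin n) :
    ∑ k, G q i k * (G q)⁻¹ k j = if i = j then 1 else 0 := by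
  rw [← Matrix.mul_apply, Matrix.mul_nonsing_inv _ (hG.isUnit_det hq), Matrix.one_apply]

theorem sum_inv_mul (hG : IsSmoothMetricOn G U) {q : Coord n} (hq : q ∈ U) (i j : Fin n) :
    ∑ k, (G q)⁻¹ i k * G q k j = if i = j then 1 else 0 := by
  rw [← Matrix.mul_apply, Matrix.nonsing_inv_mul _ (hG.isUnit_det hq), Matrix.one_apply]

theorem inv_symm (hG : IsSmoothMetricOn G U)
    {q : Coord n} (hq : q ∈ U) (i j : Fin n) : (G q)⁻¹ i j = (G q)⁻¹ j i := by
  simpa using (hG.posDef hq).inv.1.apply j i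

theorem partialDeriv_symm (hG : IsSmoothMetricOn G U) {q : Coord n} (hq : q ∈ U) (l i j : Fin n) :
    partialDeriv l (fun y => G y i j) q = partialDeriv l (fun y => G y j i) q :=
  partialDeriv_congr hG.isOpen (fun _ hy => hG.symm hy i j) hq l

/-- Cramer's rule: each cofactor is the determinant of the matrix with row `j` replaced by a
constant vector. -/
theorem contDiffOn_inv (hG : IsSmoothMetricOn G U)
    (i j : Fin n) : ContDiffOn ℝ ∞ (fun q => (G q)⁻¹ i j) U := by
  have hdet : ContDiffOn ℝ ∞ (fun q => (G q).det) U := contDiffOn_det hG.contDiffOn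
  have hadj : ContDiffOn ℝ ∞ (fun q => (G q).adjugate i j) U := by
    simp only [Matrix.adjugate_apply]
    refine contDiffOn_det fun k l => ?_
    by_cases h : k = j
    · subst h
      simpa using contDiffOn_const
    · simpa [Matrix.updateRow_ne h] using hG.contDiffOn k l
  simp only [Matrix.inv_def, Matrix.smul_apply, Ring.inverse_eq_inv', smul_eq_mul]
  exact (hdet.inv fun q hq => (hG.isUnit_det hq).ne_zero).mul hadj

theorem contDiffOn_christoffel (hG : IsSmoothMetricOn G U)
    (k i j : Fin n) : ContDiffOn ℝ ∞ (christoffel G k i j) U := by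
  have hp (a b c : Fin n) := contDiffOn_partialDeriv hG.isOpen (hG.contDiffOn b c) a
  unfold christoffel
  exact contDiffOn_const.mul (ContDiffOn.sum fun l _ =>
    (hG.contDiffOn_inv k l).mul (((hp i l j).add (hp j l i)).sub (hp l i j)))

theorem differentiableAt_christoffel (hG : IsSmoothMetricOn G U)
    {q : Coord n} (hq : q ∈ U) (k i j : Fin n) :
    DifferentiableAt ℝ (christoffel G k i j) q :=
  ((hG.contDiffOn_christoffel k i j).contDiffAt (hG.isOpen.mem_nhds hq)).differentiableAt (by simp)

theorem christoffel_symm (hG : IsSmoothMetricOn G U) {q : Coord n} (hq : q ∈ U) (k i j : Fin n) :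
    christoffel G k i j q = christoffel G k j i q := by
  unfold christoffel
  congr 1
  refine Finset.sum_congr rfl fun l _ => ?_
  rw [hG.partialDeriv_symm hq l i j]
  ring

theorem sum_mul_christoffel (hG : IsSmoothMetricOn G U) {q : Coord n} (hq : q ∈ U) (m i j : Fin n) :
    ∑ k, G q m k * christoffel G k i j q
      = (1 / 2) * (partialDeriv i (fun y => G y m j) q + partialDeriv j (fun y => G y m i) q
        - partialDeriv m (fun y => G y i j) q) := by
  set F : Fin n → ℝ := fun l =>
    partialDeriv i (fun y => G y l j) q + partialDeriv j (fun y => G y l i) q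
      - partialDeriv l (fun y => G y i j) q with hF
  calc ∑ k, G q m k * christoffel G k i j q
      = (1 / 2) * ∑ l, (∑ k, G q m k * (G q)⁻¹ k l) * F l := by
        simp only [christoffel, Finset.mul_sum, Finset.sum_mul]
        rw [Finset.sum_comm]
        refine Finset.sum_congr rfl fun l _ => Finset.sum_congr rfl fun k _ => ?_
        ring
    _ = (1 / 2) * F m := by simp [hG.sum_mul_inv hq]

/-- The Levi-Civita connection is compatible with the metric. -/
theorem partialDeriv_eq_sum_christoffel (hG : IsSmoothMetricOn G U)
    {q : Coord n} (hq : q ∈ U) (i j k : Fin n) :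
    partialDeriv i (fun y => G y j k) q
      = ∑ h, G q k h * christoffel G h i j q + ∑ h, G q j h * christoffel G h i k q := by
  rw [hG.sum_mul_christoffel hq, hG.sum_mul_christoffel hq, hG.partialDeriv_symm hq i k j,
    hG.partialDeriv_symm hq j k i, hG.partialDeriv_symm hq k j i]
  ring

/-- Differentiate `G G⁻¹ = 1` and multiply by `G⁻¹` on the left. -/
theorem partialDeriv_inv (hG : IsSmoothMetricOn G U) {q : Coord n} (hq : q ∈ U) (i j k : Fin n) :
    partialDeriv i (fun y => (G y)⁻¹ j k) q
      = -∑ l, ∑ m, (G q)⁻¹ j l * partialDeriv i (fun y => G y l m) q * (G q)⁻¹ m k := by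
  have hinv (a b : Fin n) : DifferentiableAt ℝ (fun y => (G y)⁻¹ a b) q :=
    ((hG.contDiffOn_inv a b).contDiffAt (hG.isOpen.mem_nhds hq)).differentiableAt (by simp)
  have h1 (l : Fin n) : ∑ m, (G q l m * partialDeriv i (fun y => (G y)⁻¹ m k) q
      + partialDeriv i (fun y => G y l m) q * (G q)⁻¹ m k) = 0 := by
    have h2 : partialDeriv i (fun y => ∑ m, G y l m * (G y)⁻¹ m k) q = 0 := by
      rw [partialDeriv_congr hG.isOpen (f' := fun _ => if l = k then 1 else 0)
        (fun y hy => hG.sum_mul_inv hy l k) hq]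
      simp [partialDeriv]
    rw [partialDeriv_sum (f := fun m y => G y l m * (G y)⁻¹ m k)
      fun m _ => (hG.differentiableAt hq l m).mul (hinv m k)] at h2
    rw [← h2]
    refine Finset.sum_congr rfl fun m _ => ?_
    rw [partialDeriv_mul (hG.differentiableAt hq l m) (hinv m k)]
  have h3 : ∑ l, (G q)⁻¹ j l * ∑ m, (G q l m * partialDeriv i (fun y => (G y)⁻¹ m k) q
      + partialDeriv i (fun y => G y l m) q * (G q)⁻¹ m k) = 0 := by simp [h1]
  have h4 : ∑ l, (G q)⁻¹ j l * ∑ m, G q l m * partialDeriv i (fun y => (G y)⁻¹ m k) q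
      = partialDeriv i (fun y => (G y)⁻¹ j k) q := by
    simp only [Finset.mul_sum]
    rw [Finset.sum_comm]
    simp only [← mul_assoc, ← Finset.sum_mul, hG.sum_inv_mul hq]
    simp
  simp only [Finset.sum_add_distrib, mul_add] at h3
  rw [h4] at h3
  rw [eq_neg_of_add_eq_zero_left h3]
  simp only [Finset.mul_sum, mul_assoc]

end IsSmoothMetricOn

end LocalGeometry

/-! ### Symmetries of the curvature tensor. -/

section Curvature

variable {n : ℕ} {G : Coord n → Matrix (Fin n) (Fin n) ℝ} {U : Set (Coord n)}

/-- The Christoffel symbols of the first kind `Γ_mij = g_mk Γᵏᵢⱼ`. -/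
noncomputable def loweredChristoffel (G : Coord n → Matrix (Fin n) (Fin n) ℝ) (m i j : Fin n)
    (q : Coord n) : ℝ :=
  ∑ k, G q m k * christoffel G k i j q

/-- The curvature tensor with all indices lowered, `R_mkij = g_mh Rʰₖᵢⱼ`. -/
noncomputable def loweredCurvature (G : Coord n → Matrix (Fin n) (Fin n) ℝ) (m k i j : Fin n)
    (q : Coord n) : ℝ :=
  ∑ h, G q m h * curvature G h k i j q

theorem curvature_swap (q : Coord n) (h k i j : Fin n) :
    curvature G h k i j q = -curvature G h k j i q := by
  simp only [curvature, Finset.sum_sub_distrib]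
  ring

theorem loweredCurvature_swap_right (q : Coord n) (m k i j : Fin n) :
    loweredCurvature G m k i j q = -loweredCurvature G m k j i q := by
  simp only [loweredCurvature, curvature_swap q _ k i j, mul_neg, Finset.sum_neg_distrib]

namespace IsSmoothMetricOn

/-- The first Bianchi identity. -/
theorem curvature_cyclic (hG : IsSmoothMetricOn G U) {q : Coord n} (hq : q ∈ U) (h k i j : Fin n) :
    curvature G h k i j q + curvature G h i j k q + curvature G h j k i q = 0 := by
  have hs (a b c d : Fin n) :
      partialDeriv d (christoffel G a b c) q = partialDeriv d (christoffel G a c b) q :=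
    partialDeriv_congr hG.isOpen (fun y hy => hG.christoffel_symm hy a b c) hq d
  simp only [curvature, Finset.sum_sub_distrib]
  rw [hs h i k j, hs h j k i, hs h j i k]
  have h1 (l : Fin n) : christoffel G l j k q = christoffel G l k j q :=
    hG.christoffel_symm hq l j k
  have h2 (l : Fin n) : christoffel G l i k q = christoffel G l k i q :=
    hG.christoffel_symm hq l i k
  have h3 (l : Fin n) : christoffel G l j i q = christoffel G l i j q :=
    hG.christoffel_symm hq l j i
  simp only [h1, h2, h3]
  ring

theorem loweredCurvature_cyclic (hG : IsSmoothMetricOn G U)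
    {q : Coord n} (hq : q ∈ U) (m k i j : Fin n) :
    loweredCurvature G m k i j q + loweredCurvature G m i j k q
      + loweredCurvature G m j k i q = 0 := by
  simp only [loweredCurvature, ← Finset.sum_add_distrib, ← mul_add, hG.curvature_cyclic hq,
    mul_zero, Finset.sum_const_zero]

theorem partialDeriv_eq_loweredChristoffel (hG : IsSmoothMetricOn G U)
    {q : Coord n} (hq : q ∈ U) (i j k : Fin n) :
    partialDeriv i (fun y => G y j k) q
      = loweredChristoffel G k i j q + loweredChristoffel G j i k q :=
  hG.partialDeriv_eq_sum_christoffel hq i j k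

theorem differentiableAt_loweredChristoffel (hG : IsSmoothMetricOn G U)
    {q : Coord n} (hq : q ∈ U) (m i j : Fin n) :
    DifferentiableAt ℝ (loweredChristoffel G m i j) q := by
  unfold loweredChristoffel
  exact DifferentiableAt.fun_sum fun k _ =>
    (hG.differentiableAt hq m k).mul (hG.differentiableAt_christoffel hq k i j)

theorem loweredChristoffel_symm (hG : IsSmoothMetricOn G U)
    {q : Coord n} (hq : q ∈ U) (m i j : Fin n) :
    loweredChristoffel G m i j q = loweredChristoffel G m j i q := by
  simp only [loweredChristoffel, hG.christoffel_symm hq _ i j]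

theorem sum_loweredChristoffel_mul_comm (hG : IsSmoothMetricOn G U)
    {q : Coord n} (hq : q ∈ U) (a b c d : Fin n) :
    ∑ h, loweredChristoffel G h a b q * christoffel G h c d q
      = ∑ h, loweredChristoffel G h c d q * christoffel G h a b q := by
  simp only [loweredChristoffel, Finset.sum_mul]
  rw [Finset.sum_comm]
  refine Finset.sum_congr rfl fun l _ => Finset.sum_congr rfl fun h _ => ?_
  rw [hG.symm hq]
  ring

/-- Leibniz rule for `Γ_mjk = g_mh Γʰⱼₖ`, with the derivative of the metric expressed through
Christoffel symbols. -/
theorem sum_mul_partialDeriv_christoffel (hG : IsSmoothMetricOn G U)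
    {q : Coord n} (hq : q ∈ U) (m i j k : Fin n) :
    ∑ h, G q m h * partialDeriv i (christoffel G h j k) q
      = partialDeriv i (loweredChristoffel G m j k) q
        - ∑ h, loweredChristoffel G h i m q * christoffel G h j k q
        - ∑ h, G q m h * ∑ l, christoffel G h i l q * christoffel G l j k q := by
  have h1 : partialDeriv i (loweredChristoffel G m j k) q
      = ∑ h, (G q m h * partialDeriv i (christoffel G h j k) q
        + partialDeriv i (fun y => G y m h) q * christoffel G h j k q) := by
    unfold loweredChristoffel
    rw [partialDeriv_sum (f := fun h y => G y m h * christoffel G h j k y) fun h _ =>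
      (hG.differentiableAt hq m h).mul (hG.differentiableAt_christoffel hq h j k)]
    refine Finset.sum_congr rfl fun h _ => ?_
    rw [partialDeriv_mul (hG.differentiableAt hq m h) (hG.differentiableAt_christoffel hq h j k)]
  have h2 : ∑ h, loweredChristoffel G m i h q * christoffel G h j k q
      = ∑ h, G q m h * ∑ l, christoffel G h i l q * christoffel G l j k q := by
    simp only [loweredChristoffel, Finset.sum_mul, Finset.mul_sum]
    rw [Finset.sum_comm]
    simp only [mul_assoc]
  simp only [h1, Finset.sum_add_distrib, hG.partialDeriv_eq_loweredChristoffel hq, add_mul, h2]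
  ring

/-- The quadratic terms in the definition of the curvature cancel against those from lowering the
index. In the remaining expression the skew symmetry in `m`, `k` can be read off. -/
theorem loweredCurvature_eq (hG : IsSmoothMetricOn G U)
    {q : Coord n} (hq : q ∈ U) (m k i j : Fin n) :
    loweredCurvature G m k i j q
      = partialDeriv i (loweredChristoffel G m j k) q
        - partialDeriv j (loweredChristoffel G m i k) q
        - ∑ h, loweredChristoffel G h i m q * christoffel G h j k q
        + ∑ h, loweredChristoffel G h j m q * christoffel G h i k q := by
  have h1 := hG.sum_mul_partialDeriv_christoffel hq m i j k
  have h2 := hG.sum_mul_partialDeriv_christoffel hq m j i k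
  simp only [loweredCurvature, curvature, mul_add, mul_sub, Finset.sum_add_distrib,
    Finset.sum_sub_distrib, h1, h2]
  ring

/-- The curvature operators `R(X, Y)` are skew-adjoint. -/
theorem loweredCurvature_swap_left (hG : IsSmoothMetricOn G U)
    {q : Coord n} (hq : q ∈ U) (m k i j : Fin n) :
    loweredCurvature G m k i j q = -loweredCurvature G k m i j q := by
  -- The part symmetric in `m`, `k` of the derivative terms is a second derivative of `g_mk`, so it
  -- disappears on antisymmetrizing in `i`, `j`.
  have hd (a b : Fin n) : partialDeriv a (loweredChristoffel G m b k) q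
      + partialDeriv a (loweredChristoffel G k b m) q
      = partialDeriv a (partialDeriv b fun y => G y m k) q := by
    rw [← partialDeriv_add (hG.differentiableAt_loweredChristoffel hq m b k)
      (hG.differentiableAt_loweredChristoffel hq k b m)]
    refine partialDeriv_congr hG.isOpen (fun y hy => ?_) hq a
    rw [hG.partialDeriv_eq_loweredChristoffel hy b m k, add_comm]
  have hc := partialDeriv_comm ((hG.contDiffOn m k).contDiffAt (hG.isOpen.mem_nhds hq)) i j
  rw [hG.loweredCurvature_eq hq, hG.loweredCurvature_eq hq]
  have h1 := hG.sum_loweredChristoffel_mul_comm hq i m j k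
  have h2 := hG.sum_loweredChristoffel_mul_comm hq j m i k
  linarith [hd i j, hd j i]

end IsSmoothMetricOn

end Curvature

/-! ### Algebraic curvature tensors and polarization. -/

section AlgebraicCurvature

variable {n : ℕ} (T : Fin n → Fin n → Fin n → Fin n → ℝ)

/-- The quadrilinear form with coefficients `T m k i j`. -/
noncomputable def quadrilinear (u v x y : Coord n) : ℝ :=
  ∑ m, ∑ k, ∑ i, ∑ j, T m k i j * u m * v k * x i * y j

theorem quadrilinear_stdVec (m k i j : Fin n) :
    quadrilinear T (stdVec m) (stdVec k) (stdVec i) (stdVec j) = T m k i j := by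
  simp [quadrilinear]

theorem quadrilinear_add₁ (u u' v x y : Coord n) :
    quadrilinear T (u + u') v x y = quadrilinear T u v x y + quadrilinear T u' v x y := by
  simp only [quadrilinear, ← Finset.sum_add_distrib, PiLp.add_apply]
  congr! 4
  ring

theorem quadrilinear_add₂ (u v v' x y : Coord n) :
    quadrilinear T u (v + v') x y = quadrilinear T u v x y + quadrilinear T u v' x y := by
  simp only [quadrilinear, ← Finset.sum_add_distrib, PiLp.add_apply]
  congr! 4
  ring

theorem quadrilinear_add₃ (u v x x' y : Coord n) :
    quadrilinear T u v (x + x') y = quadrilinear T u v x y + quadrilinear T u v x' y := by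
  simp only [quadrilinear, ← Finset.sum_add_distrib, PiLp.add_apply]
  congr! 4
  ring

theorem quadrilinear_add₄ (u v x y y' : Coord n) :
    quadrilinear T u v x (y + y') = quadrilinear T u v x y + quadrilinear T u v x y' := by
  simp only [quadrilinear, ← Finset.sum_add_distrib, PiLp.add_apply]
  congr! 4
  ring

theorem quadrilinear_smul₁ (r : ℝ) (u v x y : Coord n) :
    quadrilinear T (r • u) v x y = r * quadrilinear T u v x y := by
  simp only [quadrilinear, Finset.mul_sum, PiLp.smul_apply, smul_eq_mul]
  congr! 4
  ring

theorem quadrilinear_smul₂ (r : ℝ) (u v x y : Coord n) :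
    quadrilinear T u (r • v) x y = r * quadrilinear T u v x y := by
  simp only [quadrilinear, Finset.mul_sum, PiLp.smul_apply, smul_eq_mul]
  congr! 4
  ring

variable {T}

theorem quadrilinear_self (hl : ∀ m k i j, T m k i j = -T k m i j) (u x y : Coord n) :
    quadrilinear T u u x y = 0 := by
  have h : quadrilinear T u u x y = -quadrilinear T u u x y := by
    conv_lhs => rw [quadrilinear, Finset.sum_comm]
    simp only [quadrilinear, ← Finset.sum_neg_distrib]
    congr! 4 with k _ m _ i _ j
    rw [hl m k i j]
    ring
  linarith

theorem quadrilinear_eq_zero_of_dependent (hl : ∀ m k i j, T m k i j = -T k m i j)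
    {u v : Coord n} (huv : ¬LinearIndependent ℝ ![u, v]) (x y : Coord n) :
    quadrilinear T u v x y = 0 := by
  rw [LinearIndependent.pair_iff] at huv
  push Not at huv
  obtain ⟨s, t, hst, h0⟩ := huv
  have h1 := quadrilinear_smul₁ T s u v x y
  have h2 := quadrilinear_smul₂ T t u v x y
  rw [eq_neg_of_add_eq_zero_left hst, ← neg_smul, quadrilinear_smul₁, quadrilinear_self hl,
    mul_zero] at h1
  rw [eq_neg_of_add_eq_zero_right hst, ← neg_smul, quadrilinear_smul₂, quadrilinear_self hl,
    mul_zero] at h2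
  by_cases hs : s = 0
  · exact (mul_eq_zero.1 h2.symm).resolve_left (h0 hs)
  · exact (mul_eq_zero.1 h1.symm).resolve_left hs

/-- An algebraic curvature tensor is determined by its sectional curvatures. -/
theorem eq_zero_of_quadrilinear_eq_zero (hl : ∀ m k i j, T m k i j = -T k m i j)
    (hr : ∀ m k i j, T m k i j = -T m k j i)
    (hb : ∀ m k i j, T m k i j + T m i j k + T m j k i = 0)
    (h : ∀ u v, quadrilinear T u v u v = 0) (m k i j : Fin n) : T m k i j = 0 := by
  -- Pair symmetry follows from the four cyclic identities on the indices `m`, `k`, `i`, `j` and the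
  -- two skew symmetries.
  have hpair (m k i j : Fin n) : T m k i j = T i j m k := by
    linarith [hb m k i j, hb k i j m, hb i j m k, hb j m k i, hl m k i j, hl i j m k, hl m i j k,
      hl m j k i, hl k i j m, hl k j m i, hl k m i j, hl i m k j, hl j i m k, hr m k i j,
      hr i j m k, hr m i j k, hr m j k i, hr k i j m, hr k j m i, hr i m k j, hr j k i m,
      hr j m k i, hr k m i j, hr i k j m, hr j i m k, hr i j k m, hl j k i m, hl j m k i]
  -- Polarization in slots one and three; pair symmetry makes the two cross terms equal.
  have hpol (m i : Fin n) (v : Coord n) :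
      quadrilinear T (stdVec m) v (stdVec i) v = 0 := by
    have hsw : quadrilinear T (stdVec i) v (stdVec m) v
        = quadrilinear T (stdVec m) v (stdVec i) v := by
      simp only [quadrilinear, PiLp.single_apply, mul_ite, mul_one, mul_zero, ite_mul, zero_mul,
        Finset.sum_ite_irrel, Finset.sum_const_zero, Finset.sum_ite_eq', Finset.mem_univ, if_true]
      rw [Finset.sum_comm]
      congr! 2 with k _ j
      rw [hpair i j m k]
      ring
    have := h (stdVec m + stdVec i) v
    rw [quadrilinear_add₁, quadrilinear_add₃, quadrilinear_add₃, h (stdVec m) v,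
      h (stdVec i) v] at this
    linarith
  -- Polarization in slots two and four. `T` is then alternating in its last three indices, and the
  -- cyclic identity becomes `3T = 0`.
  have hanti (m k i j : Fin n) : T m k i j = -T m j i k := by
    have := hpol m i (stdVec k + stdVec j)
    rw [quadrilinear_add₂, quadrilinear_add₄, quadrilinear_add₄, hpol m i (stdVec k),
      hpol m i (stdVec j), quadrilinear_stdVec, quadrilinear_stdVec] at this
    linarith
  linarith [hb m k i j, hanti m k i j, hanti m i j k, hanti m j k i, hr m k i j, hr m i j k,
    hr m j k i]

end AlgebraicCurvature

/-! ### Constant sectional curvature as an identity between tensors. -/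

section ConstantCurvature

variable {n : ℕ} {G : Coord n → Matrix (Fin n) (Fin n) ℝ} {U : Set (Coord n)}

theorem sectionalCurvature_eq_quadrilinear_div (q u v : Coord n) :
    sectionalCurvature G q u v = quadrilinear (fun m k i j => loweredCurvature G m k i j q) u v u v
      / (metricForm G q u u * metricForm G q v v - metricForm G q u v ^ 2) := by
  unfold sectionalCurvature quadrilinear
  congr 1
  refine Finset.sum_congr rfl fun m _ => ?_
  rw [Finset.sum_comm]
  refine Finset.sum_congr rfl fun k _ => ?_
  rw [Finset.sum_comm]
  refine Finset.sum_congr rfl fun i _ => ?_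
  rw [Finset.sum_comm]
  refine Finset.sum_congr rfl fun j _ => ?_
  simp only [loweredCurvature, Finset.sum_mul]

theorem quadrilinear_metric (c : ℝ) (q u v : Coord n) :
    quadrilinear (fun m k i j => c * (G q m i * G q k j - G q m j * G q k i)) u v u v
      = c * (metricForm G q u u * metricForm G q v v
        - metricForm G q u v * metricForm G q v u) := by
  have h (a b x y : Coord n) : metricForm G q a b * metricForm G q x y
      = ∑ m, ∑ k, ∑ i, ∑ j, G q m i * G q k j * a m * x k * b i * y j := by
    unfold metricForm
    rw [Finset.sum_mul_sum]
    congr! 2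
    rw [Finset.sum_mul_sum]
    congr! 2
    ring
  simp only [h, quadrilinear, mul_sub, sub_mul, Finset.sum_sub_distrib, Finset.mul_sum]
  congr 1
  · congr! 4
    ring
  · congr! 2
    rw [Finset.sum_comm]
    congr! 2
    ring

namespace IsSmoothMetricOn

theorem metricForm_comm (hG : IsSmoothMetricOn G U) {q : Coord n} (hq : q ∈ U) (u v : Coord n) :
    metricForm G q u v = metricForm G q v u := by
  unfold metricForm
  rw [Finset.sum_comm]
  congr! 2
  rw [hG.symm hq]
  ring

theorem metricForm_pos (hG : IsSmoothMetricOn G U)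
    {q : Coord n} (hq : q ∈ U) {u : Coord n} (hu : u ≠ 0) :
    0 < metricForm G q u u := by
  have h0 : (u : Fin n → ℝ) ≠ 0 := fun h => hu (by ext i; exact congrFun h i)
  refine ((hG.posDef hq).dotProduct_mulVec_pos h0).trans_eq ?_
  simp only [dotProduct, Matrix.mulVec, star_trivial, Finset.mul_sum, metricForm]
  congr! 2
  ring

/-- The strict Cauchy–Schwarz inequality. -/
theorem gram_pos (hG : IsSmoothMetricOn G U) {q : Coord n} (hq : q ∈ U) {u v : Coord n}
    (huv : LinearIndependent ℝ ![u, v]) :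
    0 < metricForm G q u u * metricForm G q v v - metricForm G q u v ^ 2 := by
  rw [LinearIndependent.pair_iff] at huv
  have hv : v ≠ 0 := fun h => one_ne_zero (huv 0 1 (by simp [h])).2
  have hvv := hG.metricForm_pos hq hv
  set s := metricForm G q v v
  set r := metricForm G q u v
  -- This vector is `s` times the component of `u` orthogonal to `v`, and its squared length is `s`
  -- times the Gram determinant.
  have hw : s • u + (-r) • v ≠ 0 := fun h => hvv.ne' (huv _ _ h).1
  have hpos := hG.metricForm_pos hq hw
  have hexp : metricForm G q (s • u + (-r) • v) (s • u + (-r) • v)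
      = s ^ 2 * metricForm G q u u - s * r * metricForm G q u v - s * r * metricForm G q v u
        + r ^ 2 * metricForm G q v v := by
    simp only [metricForm, Finset.mul_sum, ← Finset.sum_add_distrib, ← Finset.sum_sub_distrib,
      PiLp.add_apply, PiLp.smul_apply, smul_eq_mul]
    congr! 2
    ring
  rw [hexp, hG.metricForm_comm hq v u] at hpos
  have : 0 < s * (metricForm G q u u * s - r ^ 2) := by
    refine hpos.trans_eq ?_
    ring
  exact pos_of_mul_pos_right this hvv.le

/-- The difference from the constant curvature model is an algebraic curvature tensor. Its
biquadratic form vanishes on independent pairs by hypothesis and on dependent pairs by skew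
symmetry. -/
theorem sectionalCurvature_eq_iff (hG : IsSmoothMetricOn G U) {q : Coord n} (hq : q ∈ U) (c : ℝ) :
    (∀ u v, LinearIndependent ℝ ![u, v] → sectionalCurvature G q u v = c) ↔
      ∀ m k i j, loweredCurvature G m k i j q = c * (G q m i * G q k j - G q m j * G q k i) := by
  constructor
  · intro h
    set T : Fin n → Fin n → Fin n → Fin n → ℝ := fun m k i j =>
      loweredCurvature G m k i j q - c * (G q m i * G q k j - G q m j * G q k i) with hT
    have hl (m k i j : Fin n) : T m k i j = -T k m i j := by
      simp only [hT, hG.loweredCurvature_swap_left hq m k i j]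
      ring
    have hTuv (u v : Coord n) : quadrilinear T u v u v = 0 := by
      by_cases huv : LinearIndependent ℝ ![u, v]
      · have h1 := h u v huv
        rw [sectionalCurvature_eq_quadrilinear_div, div_eq_iff (hG.gram_pos hq huv).ne'] at h1
        have h2 := quadrilinear_metric (G := G) c q u v
        have h3 : quadrilinear T u v u v
            = quadrilinear (fun m k i j => loweredCurvature G m k i j q) u v u v
              - quadrilinear (fun m k i j => c * (G q m i * G q k j - G q m j * G q k i))
                u v u v := by
          simp only [quadrilinear, hT, sub_mul, Finset.sum_sub_distrib]
        rw [h3, h1, h2, hG.metricForm_comm hq v u]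
        ring
      · exact quadrilinear_eq_zero_of_dependent hl huv u v
    intro m k i j
    refine sub_eq_zero.1 (eq_zero_of_quadrilinear_eq_zero (T := T) hl (fun m k i j => ?_)
      (fun m k i j => ?_) hTuv m k i j)
    · simp only [hT, loweredCurvature_swap_right q m k i j]
      ring
    · simp only [hT]
      have := hG.loweredCurvature_cyclic hq m k i j
      rw [hG.symm hq k j, hG.symm hq k i, hG.symm hq i j]
      linarith
  · intro h u v huv
    rw [sectionalCurvature_eq_quadrilinear_div, div_eq_iff (hG.gram_pos hq huv).ne']
    simp only [h, quadrilinear_metric, hG.metricForm_comm hq v u]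
    ring

/-- The condition of constant curvature, in terms of the contraction `p_k Rᵏ_bij`. -/
theorem loweredCurvature_eq_iff (hG : IsSmoothMetricOn G U) {q : Coord n} (hq : q ∈ U) (c : ℝ) :
    (∀ m k i j, loweredCurvature G m k i j q = c * (G q m i * G q k j - G q m j * G q k i)) ↔
      ∀ p : Coord n, p ≠ 0 → ∀ b i j, ∑ k, p k * curvature G k b i j q
        = c * (p i * G q j b - p j * G q i b) := by
  constructor
  · intro h p _ b i j
    have hu (k : Fin n) : curvature G k b i j q
        = ∑ m, (G q)⁻¹ k m * loweredCurvature G m b i j q := by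
      simp only [loweredCurvature, Finset.mul_sum]
      rw [Finset.sum_comm]
      simp only [← mul_assoc, ← Finset.sum_mul, hG.sum_inv_mul hq]
      simp
    have hu' (k : Fin n) : curvature G k b i j q
        = c * ((if k = i then 1 else 0) * G q b j - (if k = j then 1 else 0) * G q b i) := by
      rw [hu, ← hG.sum_inv_mul hq k i, ← hG.sum_inv_mul hq k j]
      simp only [h, Finset.sum_mul, ← Finset.sum_sub_distrib, Finset.mul_sum]
      congr! 1
      ring
    simp only [hu', mul_sub, Finset.sum_sub_distrib]
    simp
    rw [hG.symm hq b j, hG.symm hq b i]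
    ring
  · intro h m b i j
    have hu (k : Fin n) : curvature G k b i j q
        = c * ((if k = i then 1 else 0) * G q b j - (if k = j then 1 else 0) * G q b i) := by
      -- The nonzero covector `dxᵏ` isolates the single component `Rᵏ_bij`.
      have h0 : (stdVec k : Coord n) ≠ 0 := by simp
      have := h (stdVec k) h0 b i j
      simp only [PiLp.single_apply] at this
      simp at this
      rw [this, hG.symm hq b j, hG.symm hq b i]
      simp only [eq_comm (a := k)]
      split_ifs <;> simp
    simp only [loweredCurvature, hu, mul_sub, Finset.sum_sub_distrib]
    simp
    ring

end IsSmoothMetricOn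

end ConstantCurvature

/-! ### Smoothness of `J` on phase space, and the span of the horizontal vectors and their images.
-/

section PhaseSpace

variable {n : ℕ} {G : Coord n → Matrix (Fin n) (Fin n) ℝ} {U : Set (Coord n)}

/-- The part of `ℝⁿ × ℝⁿ` over `U`, without the zero section. -/
def puncturedPhase (U : Set (Coord n)) : Set (Phase n) := {z | z.1 ∈ U ∧ z.2 ≠ 0}

theorem isOpen_puncturedPhase (hU : IsOpen U) : IsOpen (puncturedPhase U) :=
  (hU.preimage continuous_fst).inter (isOpen_compl_singleton.preimage continuous_snd)

theorem contDiffOn_comp_fst {f : Coord n → ℝ} (hf : ContDiffOn ℝ ∞ f U) :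
    ContDiffOn ℝ ∞ (fun z : Phase n => f z.1) (puncturedPhase U) :=
  hf.comp contDiff_fst.contDiffOn fun _ hz => hz.1

theorem contDiff_snd_apply (i : Fin n) : ContDiff ℝ ∞ (fun z : Phase n => z.2 i) := by
  have : ContDiff ℝ ∞ (fun v : Coord n => v i) := (EuclideanSpace.proj (𝕜 := ℝ) i).contDiff
  exact this.comp contDiff_snd

theorem fderiv_snd_apply (i : Fin n) (z v : Phase n) :
    fderiv ℝ (fun w : Phase n => w.2 i) z v = v.2 i := by
  have : HasFDerivAt (fun w : Phase n => w.2 i)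
      ((EuclideanSpace.proj (𝕜 := ℝ) i).comp (ContinuousLinearMap.snd ℝ (Coord n) (Coord n))) z :=
    ((EuclideanSpace.proj (𝕜 := ℝ) i).comp
      (ContinuousLinearMap.snd ℝ (Coord n) (Coord n))).hasFDerivAt
  rw [this.fderiv]
  rfl

theorem fderiv_comp_fst {f : Coord n → ℝ} {z : Phase n} (hf : DifferentiableAt ℝ f z.1)
    (v : Phase n) : fderiv ℝ (fun w : Phase n => f w.1) z v = fderiv ℝ f z.1 v.1 := by
  have : HasFDerivAt (fun w : Phase n => f w.1)
      ((fderiv ℝ f z.1).comp (ContinuousLinearMap.fst ℝ (Coord n) (Coord n))) z :=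
    hf.hasFDerivAt.comp z hasFDerivAt_fst
  rw [this.fderiv]
  rfl

theorem fderiv_mul_apply {f f' : Phase n → ℝ} {z : Phase n} (hf : DifferentiableAt ℝ f z)
    (hf' : DifferentiableAt ℝ f' z) (v : Phase n) :
    fderiv ℝ (fun w => f w * f' w) z v = f z * fderiv ℝ f' z v + fderiv ℝ f z v * f' z := by
  rw [fderiv_fun_mul hf hf']
  simp [mul_comm]

theorem fderiv_sum_apply {ι : Type*} {s : Finset ι} {f : ι → Phase n → ℝ} {z : Phase n}
    (hf : ∀ k ∈ s, DifferentiableAt ℝ (f k) z) (v : Phase n) :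
    fderiv ℝ (fun w => ∑ k ∈ s, f k w) z v = ∑ k ∈ s, fderiv ℝ (f k) z v := by
  rw [fderiv_fun_sum hf]
  simp

theorem fderiv_add_apply {f f' : Phase n → ℝ} {z : Phase n} (hf : DifferentiableAt ℝ f z)
    (hf' : DifferentiableAt ℝ f' z) (v : Phase n) :
    fderiv ℝ (fun w => f w + f' w) z v = fderiv ℝ f z v + fderiv ℝ f' z v := by
  rw [fderiv_fun_add hf hf']
  rfl

theorem fderiv_comp_real {φ : ℝ → ℝ} {f : Phase n → ℝ} {z : Phase n}
    (hφ : DifferentiableAt ℝ φ (f z)) (hf : DifferentiableAt ℝ f z) (v : Phase n) :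
    fderiv ℝ (fun w => φ (f w)) z v = deriv φ (f z) * fderiv ℝ f z v := by
  have := hφ.hasDerivAt.comp_hasFDerivAt z hf.hasFDerivAt
  rw [HasFDerivAt.fderiv (f := fun w => φ (f w)) this]
  simp

/-- The vertical vector with components `f`. -/
theorem sum_smul_vertVec (f : Fin n → ℝ) :
    ∑ h, f h • (vertVec h : Phase n) = (0, WithLp.toLp 2 f) := by
  refine Prod.ext ?_ ?_
  · simp [Prod.fst_sum, vertVec]
  · ext j
    simp [Prod.snd_sum, vertVec, Pi.single_apply]

namespace IsSmoothMetricOn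

theorem contDiffOn_energy (hG : IsSmoothMetricOn G U)
    : ContDiffOn ℝ ∞ (energy G) (puncturedPhase U) := by
  unfold energy
  exact contDiffOn_const.mul (ContDiffOn.sum fun i _ => ContDiffOn.sum fun k _ =>
    ((contDiffOn_comp_fst (hG.contDiffOn_inv i k)).mul (contDiff_snd_apply i).contDiffOn).mul
      (contDiff_snd_apply k).contDiffOn)

/-- Positivity keeps `t` in `(0, ∞)`, where the coefficient functions are smooth. -/
theorem energy_pos (hG : IsSmoothMetricOn G U)
    {z : Phase n} (hz : z ∈ puncturedPhase U) : 0 < energy G z := by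
  have h0 : (z.2 : Fin n → ℝ) ≠ 0 := fun h => hz.2 (by ext i; exact congrFun h i)
  have := (hG.posDef hz.1).inv.dotProduct_mulVec_pos h0
  unfold energy
  refine mul_pos (by norm_num) (this.trans_eq ?_)
  simp only [dotProduct, Matrix.mulVec, star_trivial, Finset.mul_sum]
  congr! 2
  ring

theorem contDiffOn_comp_energy (hG : IsSmoothMetricOn G U)
    {a : ℝ → ℝ} (ha : ContDiffOn ℝ ∞ a (Set.Ioi 0)) :
    ContDiffOn ℝ ∞ (fun z => a (energy G z)) (puncturedPhase U) :=
  ha.comp hG.contDiffOn_energy fun _ hz => hG.energy_pos hz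

theorem contDiffOn_raised (hG : IsSmoothMetricOn G U) (i : Fin n) :
    ContDiffOn ℝ ∞ (fun z => raised G z i) (puncturedPhase U) := by
  unfold raised
  exact ContDiffOn.sum fun h _ =>
    (contDiff_snd_apply h).contDiffOn.mul (contDiffOn_comp_fst (hG.contDiffOn_inv h i))

theorem contDiffOn_christoffelZero (hG : IsSmoothMetricOn G U) (i h : Fin n) :
    ContDiffOn ℝ ∞ (fun z => christoffelZero G z i h) (puncturedPhase U) := by
  unfold christoffelZero
  exact ContDiffOn.sum fun k _ =>
    (contDiff_snd_apply k).contDiffOn.mul (contDiffOn_comp_fst (hG.contDiffOn_christoffel k i h))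

theorem contDiffOn_horVec (hG : IsSmoothMetricOn G U) (i : Fin n) :
    ContDiffOn ℝ ∞ (fun z => horVec G z i) (puncturedPhase U) := by
  unfold horVec
  exact contDiffOn_const.add (ContDiffOn.sum fun h _ =>
    (hG.contDiffOn_christoffelZero i h).smul contDiffOn_const)

theorem contDiffOn_J1 (hG : IsSmoothMetricOn G U)
    {a₁ b₁ : ℝ → ℝ} (ha₁ : ContDiffOn ℝ ∞ a₁ (Set.Ioi 0))
    (hb₁ : ContDiffOn ℝ ∞ b₁ (Set.Ioi 0)) (i j : Fin n) :
    ContDiffOn ℝ ∞ (fun z => J1 G a₁ b₁ z i j) (puncturedPhase U) := by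
  unfold J1
  exact ((hG.contDiffOn_comp_energy ha₁).mul (contDiffOn_comp_fst (hG.contDiffOn i j))).add
    (((hG.contDiffOn_comp_energy hb₁).mul (contDiff_snd_apply i).contDiffOn).mul
      (contDiff_snd_apply j).contDiffOn)

theorem contDiffOn_J2 (hG : IsSmoothMetricOn G U)
    {a₂ b₂ : ℝ → ℝ} (ha₂ : ContDiffOn ℝ ∞ a₂ (Set.Ioi 0))
    (hb₂ : ContDiffOn ℝ ∞ b₂ (Set.Ioi 0)) (i j : Fin n) :
    ContDiffOn ℝ ∞ (fun z => J2 G a₂ b₂ z i j) (puncturedPhase U) := by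
  unfold J2
  exact ((hG.contDiffOn_comp_energy ha₂).mul (contDiffOn_comp_fst (hG.contDiffOn_inv i j))).add
    (((hG.contDiffOn_comp_energy hb₂).mul (hG.contDiffOn_raised i)).mul (hG.contDiffOn_raised j))

theorem contDiffOn_diagJ (hG : IsSmoothMetricOn G U)
    {a₁ a₂ b₁ b₂ : ℝ → ℝ} (ha₁ : ContDiffOn ℝ ∞ a₁ (Set.Ioi 0))
    (ha₂ : ContDiffOn ℝ ∞ a₂ (Set.Ioi 0)) (hb₁ : ContDiffOn ℝ ∞ b₁ (Set.Ioi 0))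
    (hb₂ : ContDiffOn ℝ ∞ b₂ (Set.Ioi 0)) (X : Phase n) :
    ContDiffOn ℝ ∞ (fun z => diagJ G a₁ a₂ b₁ b₂ z X) (puncturedPhase U) := by
  unfold diagJ horComp vertComp
  refine ContDiffOn.sub (ContDiffOn.sum fun i _ => ContDiffOn.sum fun j _ => ?_)
    (ContDiffOn.sum fun i _ => ContDiffOn.sum fun j _ => ?_)
  · exact (contDiffOn_const.mul (hG.contDiffOn_J1 ha₁ hb₁ i j)).smul contDiffOn_const
  · exact ((contDiffOn_const.sub (ContDiffOn.sum fun k _ =>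
      contDiffOn_const.mul (hG.contDiffOn_christoffelZero k i))).mul
        (hG.contDiffOn_J2 ha₂ hb₂ i j)).smul (hG.contDiffOn_horVec j)

end IsSmoothMetricOn

/-- `diagJ` as a field of continuous linear operators. -/
noncomputable def diagJL (G : Coord n → Matrix (Fin n) (Fin n) ℝ) (a₁ a₂ b₁ b₂ : ℝ → ℝ)
    (z : Phase n) : Phase n →L[ℝ] Phase n :=
  LinearMap.toContinuousLinearMap
    { toFun := diagJ G a₁ a₂ b₁ b₂ z
      map_add' := fun X Y => by
        simp only [diagJ, horComp, vertComp, Prod.fst_add, Prod.snd_add, PiLp.add_apply, add_mul,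
          Finset.sum_add_distrib, add_sub_add_comm, add_smul]
      map_smul' := fun r X => by
        simp only [diagJ, horComp, vertComp, Prod.smul_fst, Prod.smul_snd, PiLp.smul_apply,
          smul_eq_mul, mul_assoc, ← Finset.mul_sum, ← mul_sub, mul_smul, ← Finset.smul_sum,
          ← smul_sub, RingHom.id_apply] }

theorem diagJL_apply (a₁ a₂ b₁ b₂ : ℝ → ℝ) (z X : Phase n) :
    diagJL G a₁ a₂ b₁ b₂ z X = diagJ G a₁ a₂ b₁ b₂ z X := rfl

theorem IsSmoothMetricOn.differentiableAt_diagJL (hG : IsSmoothMetricOn G U)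
    {a₁ a₂ b₁ b₂ : ℝ → ℝ} (ha₁ : ContDiffOn ℝ ∞ a₁ (Set.Ioi 0))
    (ha₂ : ContDiffOn ℝ ∞ a₂ (Set.Ioi 0)) (hb₁ : ContDiffOn ℝ ∞ b₁ (Set.Ioi 0))
    (hb₂ : ContDiffOn ℝ ∞ b₂ (Set.Ioi 0)) {z : Phase n} (hz : z ∈ puncturedPhase U) :
    DifferentiableAt ℝ (diagJL G a₁ a₂ b₁ b₂) z := by
  have h : ContDiffOn ℝ ∞ (diagJL G a₁ a₂ b₁ b₂) (puncturedPhase U) :=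
    contDiffOn_clm_apply.2 fun X => hG.contDiffOn_diagJ ha₁ ha₂ hb₁ hb₂ X
  exact (h.contDiffAt ((isOpen_puncturedPhase hG.isOpen).mem_nhds hz)).differentiableAt (by simp)

/-- Applying `J` to `J ∂/∂pₕ = -J₍₂₎ʰʲ δ/δqʲ` exhibits `∂/∂pₕ` as the image of a horizontal vector.
-/
theorem exists_eq_horizontal_add_map (a₁ a₂ b₁ b₂ : ℝ → ℝ) {z : Phase n}
    (hsq : ∀ X, diagJL G a₁ a₂ b₁ b₂ z (diagJL G a₁ a₂ b₁ b₂ z X) = -X) (x : Phase n) :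
    ∃ u ∈ Submodule.span ℝ (Set.range (horVec G z)),
      ∃ v ∈ Submodule.span ℝ (Set.range (horVec G z)), x = u + diagJL G a₁ a₂ b₁ b₂ z v := by
  have hmem (f : Fin n → ℝ) : ∑ i, f i • horVec G z i
      ∈ Submodule.span ℝ (Set.range (horVec G z)) :=
    Submodule.sum_mem _ fun i _ => Submodule.smul_mem _ _ (Submodule.subset_span ⟨i, rfl⟩)
  refine ⟨∑ i, horComp x i • horVec G z i, hmem _,
    ∑ h, vertComp G z x h • ∑ j, J2 G a₂ b₂ z h j • horVec G z j,
    Submodule.sum_mem _ fun h _ => Submodule.smul_mem _ _ (hmem _), ?_⟩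
  conv_lhs => rw [adapted_expansion G z x]
  congr 1
  rw [map_sum]
  refine Finset.sum_congr rfl fun h _ => ?_
  rw [map_smul]
  congr 1
  rw [← neg_neg (∑ j, J2 G a₂ b₂ z h j • horVec G z j), ← diagJ_vertVec G a₁ a₂ b₁ b₂ z h, map_neg,
    ← diagJL_apply, hsq, neg_neg]

end PhaseSpace

/-! ### Derivatives of the energy and of the coefficients along the frame. -/

section Brackets

variable {n : ℕ} {G : Coord n → Matrix (Fin n) (Fin n) ℝ} {U : Set (Coord n)}

/-- The vertical vector `J δ/δqⁱ` with components `J⁽¹⁾ᵢⱼ`. -/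
noncomputable def rowJ1 (G : Coord n → Matrix (Fin n) (Fin n) ℝ) (a₁ b₁ : ℝ → ℝ) (z : Phase n)
    (i : Fin n) : Phase n :=
  ∑ j, J1 G a₁ b₁ z i j • vertVec j

theorem rowJ1_fst (a₁ b₁ : ℝ → ℝ) (z : Phase n) (i : Fin n) : (rowJ1 G a₁ b₁ z i).1 = 0 := by
  rw [rowJ1, sum_smul_vertVec]

theorem rowJ1_snd (a₁ b₁ : ℝ → ℝ) (z : Phase n) (i j : Fin n) :
    (rowJ1 G a₁ b₁ z i).2 j = J1 G a₁ b₁ z i j := by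
  rw [rowJ1, sum_smul_vertVec]

theorem fderiv_sum_smul_vertVec {f : Fin n → Phase n → ℝ} {z : Phase n}
    (hf : ∀ h, DifferentiableAt ℝ (f h) z) (c v : Phase n) :
    fderiv ℝ (fun w => c + ∑ h, f h w • vertVec h) z v
      = ∑ h, fderiv ℝ (f h) z v • vertVec h := by
  have : HasFDerivAt (fun w => c + ∑ h, f h w • (vertVec h : Phase n))
      (∑ h, (fderiv ℝ (f h) z).smulRight (vertVec h : Phase n)) z :=
    (HasFDerivAt.fun_sum fun h _ => (hf h).hasFDerivAt.smul_const _).const_add c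
  rw [this.fderiv]
  simp

theorem sum_snd_mul_raised (z : Phase n) : ∑ b, z.2 b * raised G z b = 2 * energy G z := by
  simp only [raised, energy, Finset.mul_sum]
  rw [Finset.sum_comm]
  congr! 2
  ring

namespace IsSmoothMetricOn

theorem sum_mul_raised (hG : IsSmoothMetricOn G U)
    {z : Phase n} (hz : z ∈ puncturedPhase U) (k : Fin n) :
    ∑ b, G z.1 k b * raised G z b = z.2 k := by
  have h (b : Fin n) : raised G z b = ∑ h, (G z.1)⁻¹ b h * z.2 h := by
    refine Finset.sum_congr rfl fun h _ => ?_
    rw [hG.inv_symm hz.1]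
    ring
  simp only [h, Finset.mul_sum]
  rw [Finset.sum_comm]
  simp only [← mul_assoc, ← Finset.sum_mul, hG.sum_mul_inv hz.1]
  simp

theorem fderiv_christoffelZero (hG : IsSmoothMetricOn G U)
    {z : Phase n} (hz : z ∈ puncturedPhase U) (i h : Fin n)
    (v : Phase n) : fderiv ℝ (fun w => christoffelZero G w i h) z v
      = ∑ k, (z.2 k * fderiv ℝ (christoffel G k i h) z.1 v.1
        + v.2 k * christoffel G k i h z.1) := by
  have hd (k : Fin n) := hG.differentiableAt_christoffel hz.1 k i h
  have hp (k : Fin n) : DifferentiableAt ℝ (fun w : Phase n => w.2 k) z :=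
    (contDiff_snd_apply k).contDiffAt.differentiableAt (by simp)
  have hd' (k : Fin n) : DifferentiableAt ℝ (fun w : Phase n => christoffel G k i h w.1) z :=
    (hd k).comp z differentiableAt_fst
  unfold christoffelZero
  rw [fderiv_sum_apply (f := fun k w => w.2 k * christoffel G k i h w.1)
    fun k _ => (hp k).mul (hd' k)]
  refine Finset.sum_congr rfl fun k _ => ?_
  rw [fderiv_mul_apply (hp k) (hd' k), fderiv_snd_apply, fderiv_comp_fst (hd k)]

theorem fderiv_energy (hG : IsSmoothMetricOn G U)
    {z : Phase n} (hz : z ∈ puncturedPhase U) (v : Phase n) :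
    fderiv ℝ (energy G) z v = ∑ i, v.2 i * raised G z i
      + (1 / 2) * ∑ i, ∑ k, fderiv ℝ (fun q => (G q)⁻¹ i k) z.1 v.1 * z.2 i * z.2 k := by
  have hd (i k : Fin n) : DifferentiableAt ℝ (fun q => (G q)⁻¹ i k) z.1 :=
    ((hG.contDiffOn_inv i k).contDiffAt (hG.isOpen.mem_nhds hz.1)).differentiableAt (by simp)
  have hp (k : Fin n) : DifferentiableAt ℝ (fun w : Phase n => w.2 k) z :=
    (contDiff_snd_apply k).contDiffAt.differentiableAt (by simp)
  have hd' (i k : Fin n) : DifferentiableAt ℝ (fun w : Phase n => (G w.1)⁻¹ i k) z :=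
    (hd i k).comp z differentiableAt_fst
  have hterm (i k : Fin n) :
      DifferentiableAt ℝ (fun w : Phase n => (G w.1)⁻¹ i k * w.2 i * w.2 k) z :=
    ((hd' i k).mul (hp i)).mul (hp k)
  have h1 : fderiv ℝ (energy G) z v
      = (1 / 2) * ∑ i, ∑ k, ((G z.1)⁻¹ i k * z.2 i * v.2 k
        + ((G z.1)⁻¹ i k * v.2 i
          + fderiv ℝ (fun q => (G q)⁻¹ i k) z.1 v.1 * z.2 i) * z.2 k) := by
    unfold energy
    rw [fderiv_mul_apply (differentiableAt_const _) (DifferentiableAt.fun_sum fun i _ =>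
      DifferentiableAt.fun_sum fun k _ => hterm i k)]
    simp only [fderiv_fun_const, Pi.zero_apply, zero_apply, zero_mul, add_zero]
    congr 1
    rw [fderiv_sum_apply (f := fun i w => ∑ k, (G w.1)⁻¹ i k * w.2 i * w.2 k)
      fun i _ => DifferentiableAt.fun_sum fun k _ => hterm i k]
    refine Finset.sum_congr rfl fun i _ => ?_
    rw [fderiv_sum_apply (f := fun k w => (G w.1)⁻¹ i k * w.2 i * w.2 k) fun k _ => hterm i k]
    refine Finset.sum_congr rfl fun k _ => ?_
    rw [fderiv_mul_apply ((hd' i k).fun_mul (hp i)) (hp k), fderiv_mul_apply (hd' i k) (hp i),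
      fderiv_snd_apply, fderiv_snd_apply, fderiv_comp_fst (hd i k)]
  have h2 : ∑ i, ∑ k, (G z.1)⁻¹ i k * z.2 i * v.2 k = ∑ i, v.2 i * raised G z i := by
    rw [Finset.sum_comm]
    simp only [raised, Finset.mul_sum]
    congr! 2
    ring
  have h3 : ∑ i, ∑ k, (G z.1)⁻¹ i k * v.2 i * z.2 k = ∑ i, v.2 i * raised G z i := by
    simp only [raised, Finset.mul_sum]
    congr! 2 with i _ k
    rw [hG.inv_symm hz.1]
    ring
  rw [h1]
  simp only [add_mul, Finset.sum_add_distrib, h2, h3]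
  ring

/-- The energy density is constant along the horizontal distribution. -/
theorem fderiv_energy_horVec (hG : IsSmoothMetricOn G U)
    {z : Phase n} (hz : z ∈ puncturedPhase U) (i : Fin n) :
    fderiv ℝ (energy G) z (horVec G z i) = 0 := by
  rw [hG.fderiv_energy hz, horVec_fst]
  have hr (l : Fin n) : raised G z l = ∑ j, z.2 j * (G z.1)⁻¹ j l := rfl
  have hr' (l : Fin n) : raised G z l = ∑ j, (G z.1)⁻¹ l j * z.2 j := by
    rw [hr]
    refine Finset.sum_congr rfl fun j _ => ?_
    rw [hG.inv_symm hz.1]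
    ring
  have h1 : ∑ j, ∑ k, fderiv ℝ (fun q => (G q)⁻¹ j k) z.1 (stdVec i) * z.2 j * z.2 k
      = -∑ l, ∑ m, raised G z l * partialDeriv i (fun y => G y l m) z.1 * raised G z m := by
    have : ∀ j k, fderiv ℝ (fun q => (G q)⁻¹ j k) z.1 (stdVec i)
        = -∑ l, ∑ m, (G z.1)⁻¹ j l * partialDeriv i (fun y => G y l m) z.1 * (G z.1)⁻¹ m k :=
      fun j k => hG.partialDeriv_inv hz.1 i j k
    simp only [this, neg_mul, Finset.sum_neg_distrib, Finset.sum_mul]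
    congr 1
    have hexp (l m : Fin n) : raised G z l * partialDeriv i (fun y => G y l m) z.1 * raised G z m
        = ∑ j, ∑ k, (G z.1)⁻¹ j l * partialDeriv i (fun y => G y l m) z.1 * (G z.1)⁻¹ m k
          * z.2 j * z.2 k := by
      rw [hr l, hr' m]
      simp only [Finset.sum_mul, Finset.mul_sum]
      rw [Finset.sum_comm]
      congr! 2
      ring
    simp only [hexp]
    calc _ = ∑ j, ∑ l, ∑ k, ∑ m, (G z.1)⁻¹ j l * partialDeriv i (fun y => G y l m) z.1
          * (G z.1)⁻¹ m k * z.2 j * z.2 k := Finset.sum_congr rfl fun j _ => Finset.sum_comm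
      _ = ∑ l, ∑ j, ∑ m, ∑ k, (G z.1)⁻¹ j l * partialDeriv i (fun y => G y l m) z.1
          * (G z.1)⁻¹ m k * z.2 j * z.2 k := by
        rw [Finset.sum_comm]
        exact Finset.sum_congr rfl fun l _ => Finset.sum_congr rfl fun j _ => Finset.sum_comm
      _ = _ := Finset.sum_congr rfl fun l _ => Finset.sum_comm
  -- Metric compatibility splits the derivative of `g` into two equal contractions. With the factor
  -- `-½` they cancel the contribution of the vertical part of `δ/δqⁱ`.
  have h2 : ∑ l, ∑ m, raised G z l * partialDeriv i (fun y => G y l m) z.1 * raised G z m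
      = 2 * ∑ l, christoffelZero G z i l * raised G z l := by
    have h3 (l : Fin n) : ∑ m, loweredChristoffel G m i l z.1 * raised G z m
        = christoffelZero G z i l := by
      simp only [loweredChristoffel, Finset.sum_mul, christoffelZero]
      rw [Finset.sum_comm]
      refine Finset.sum_congr rfl fun k _ => ?_
      rw [← hG.sum_mul_raised hz k, Finset.sum_mul]
      refine Finset.sum_congr rfl fun m _ => ?_
      rw [hG.symm hz.1]
      ring
    have h4 : ∑ l, ∑ m, raised G z l * loweredChristoffel G m i l z.1 * raised G z m
        = ∑ l, christoffelZero G z i l * raised G z l := by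
      refine Finset.sum_congr rfl fun l _ => ?_
      rw [← h3 l, Finset.sum_mul]
      refine Finset.sum_congr rfl fun m _ => ?_
      ring
    have h5 : ∑ l, ∑ m, raised G z l * loweredChristoffel G l i m z.1 * raised G z m
        = ∑ l, christoffelZero G z i l * raised G z l := by
      rw [← h4, Finset.sum_comm]
      congr! 2
      ring
    simp only [hG.partialDeriv_eq_loweredChristoffel hz.1, mul_add, add_mul,
      Finset.sum_add_distrib, h4, h5]
    ring
  rw [h1, h2]
  simp only [horVec_snd]
  ring

/-- The vertical gradient of `t` is `g⁰ˣ`, with `g_kx g⁰ˣ = p_k` and `p_x g⁰ˣ = 2t`. -/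
theorem fderiv_energy_rowJ1 (hG : IsSmoothMetricOn G U)
    {a₁ b₁ : ℝ → ℝ} {z : Phase n} (hz : z ∈ puncturedPhase U)
    (k : Fin n) : fderiv ℝ (energy G) z (rowJ1 G a₁ b₁ z k)
      = (a₁ (energy G z) + 2 * energy G z * b₁ (energy G z)) * z.2 k := by
  rw [hG.fderiv_energy hz, rowJ1_fst]
  simp only [map_zero, zero_mul, Finset.sum_const_zero, mul_zero, add_zero, rowJ1_snd, J1, add_mul,
    Finset.sum_add_distrib]
  have h1 : ∑ x, a₁ (energy G z) * G z.1 k x * raised G z x = a₁ (energy G z) * z.2 k := by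
    rw [← hG.sum_mul_raised hz k, Finset.mul_sum]
    simp only [mul_assoc]
  have h2 : ∑ x, b₁ (energy G z) * z.2 k * z.2 x * raised G z x
      = b₁ (energy G z) * z.2 k * (2 * energy G z) := by
    rw [← sum_snd_mul_raised z, Finset.mul_sum]
    simp only [mul_assoc]
  rw [h1, h2]
  ring

variable {a₁ b₁ : ℝ → ℝ}

theorem fderiv_J1 (hG : IsSmoothMetricOn G U)
    (ha₁ : ContDiffOn ℝ ∞ a₁ (Set.Ioi 0)) (hb₁ : ContDiffOn ℝ ∞ b₁ (Set.Ioi 0))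
    {z : Phase n} (hz : z ∈ puncturedPhase U) (i j : Fin n) (v : Phase n) :
    fderiv ℝ (fun w => J1 G a₁ b₁ w i j) z v
      = deriv a₁ (energy G z) * fderiv ℝ (energy G) z v * G z.1 i j
        + a₁ (energy G z) * fderiv ℝ (fun q => G q i j) z.1 v.1
        + deriv b₁ (energy G z) * fderiv ℝ (energy G) z v * z.2 i * z.2 j
        + b₁ (energy G z) * (v.2 i * z.2 j + z.2 i * v.2 j) := by
  have he : DifferentiableAt ℝ (energy G) z :=
    (hG.contDiffOn_energy.contDiffAt
      ((isOpen_puncturedPhase hG.isOpen).mem_nhds hz)).differentiableAt (by simp)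
  have hreal {a : ℝ → ℝ} (ha : ContDiffOn ℝ ∞ a (Set.Ioi 0)) : DifferentiableAt ℝ a (energy G z) :=
    (ha.contDiffAt (isOpen_Ioi.mem_nhds (hG.energy_pos hz))).differentiableAt (by simp)
  have hcomp {a : ℝ → ℝ} (ha : ContDiffOn ℝ ∞ a (Set.Ioi 0)) :
      DifferentiableAt ℝ (fun w => a (energy G w)) z := (hreal ha).comp z he
  have hd := hG.differentiableAt hz.1 i j
  have hd' : DifferentiableAt ℝ (fun w : Phase n => G w.1 i j) z := hd.comp z differentiableAt_fst
  have hp (k : Fin n) : DifferentiableAt ℝ (fun w : Phase n => w.2 k) z :=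
    (contDiff_snd_apply k).contDiffAt.differentiableAt (by simp)
  unfold J1
  rw [fderiv_add_apply ((hcomp ha₁).fun_mul hd') (((hcomp hb₁).fun_mul (hp i)).fun_mul (hp j)),
    fderiv_mul_apply (hcomp ha₁) hd', fderiv_mul_apply ((hcomp hb₁).fun_mul (hp i)) (hp j),
    fderiv_mul_apply (hcomp hb₁) (hp i), fderiv_comp_real (hreal ha₁) he,
    fderiv_comp_real (hreal hb₁) he, fderiv_comp_fst hd, fderiv_snd_apply, fderiv_snd_apply]
  ring

end IsSmoothMetricOn

end Brackets

/-! ### Brackets of the adapted frame and the local criterion. -/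

section Integrability

variable {n : ℕ} {G : Coord n → Matrix (Fin n) (Fin n) ℝ} {U : Set (Coord n)}
  {a₁ a₂ b₁ b₂ : ℝ → ℝ}

/-- Both `δ/δqⁱ` and `J δ/δqⁱ` are a constant field plus a vertical one, so all their brackets are
vertical and computed coefficient by coefficient. -/
theorem lieBracket_sum_smul_vertVec {f f' : Fin n → Phase n → ℝ} {z : Phase n}
    (hf : ∀ h, DifferentiableAt ℝ (f h) z) (hf' : ∀ h, DifferentiableAt ℝ (f' h) z)
    (c c' : Phase n) :
    VectorField.lieBracket ℝ (fun w => c + ∑ h, f h w • vertVec h)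
        (fun w => c' + ∑ h, f' h w • vertVec h) z
      = ∑ h, (fderiv ℝ (f' h) z (c + ∑ h, f h z • vertVec h)
          - fderiv ℝ (f h) z (c' + ∑ h, f' h z • vertVec h)) • vertVec h := by
  rw [VectorField.lieBracket, fderiv_sum_smul_vertVec hf', fderiv_sum_smul_vertVec hf,
    ← Finset.sum_sub_distrib]
  simp only [sub_smul]

namespace IsSmoothMetricOn

theorem differentiableAt_christoffelZero (hG : IsSmoothMetricOn G U)
    {z : Phase n} (hz : z ∈ puncturedPhase U)
    (i h : Fin n) : DifferentiableAt ℝ (fun w => christoffelZero G w i h) z :=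
  ((hG.contDiffOn_christoffelZero i h).contDiffAt
    ((isOpen_puncturedPhase hG.isOpen).mem_nhds hz)).differentiableAt (by simp)

theorem differentiableAt_J1 (hG : IsSmoothMetricOn G U) (ha₁ : ContDiffOn ℝ ∞ a₁ (Set.Ioi 0))
    (hb₁ : ContDiffOn ℝ ∞ b₁ (Set.Ioi 0)) {z : Phase n} (hz : z ∈ puncturedPhase U)
    (i j : Fin n) : DifferentiableAt ℝ (fun w => J1 G a₁ b₁ w i j) z :=
  ((hG.contDiffOn_J1 ha₁ hb₁ i j).contDiffAt
    ((isOpen_puncturedPhase hG.isOpen).mem_nhds hz)).differentiableAt (by simp)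

theorem christoffelZero_symm (hG : IsSmoothMetricOn G U)
    {z : Phase n} (hz : z ∈ puncturedPhase U) (i j : Fin n) :
    christoffelZero G z i j = christoffelZero G z j i := by
  simp only [christoffelZero, hG.christoffel_symm hz.1 _ i j]

/-- The curvature of the horizontal distribution. -/
theorem lieBracket_horVec (hG : IsSmoothMetricOn G U)
    {z : Phase n} (hz : z ∈ puncturedPhase U) (i j : Fin n) :
    VectorField.lieBracket ℝ (fun w => horVec G w i) (fun w => horVec G w j) z
      = ∑ b, (∑ k, z.2 k * curvature G k b i j z.1) • vertVec b := by
  unfold horVec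
  rw [lieBracket_sum_smul_vertVec (hG.differentiableAt_christoffelZero hz i)
    (hG.differentiableAt_christoffelZero hz j)]
  refine Finset.sum_congr rfl fun b _ => ?_
  congr 1
  change fderiv ℝ (fun w => christoffelZero G w j b) z (horVec G z i)
    - fderiv ℝ (fun w => christoffelZero G w i b) z (horVec G z j) = _
  have h (a c : Fin n) : fderiv ℝ (fun w => christoffelZero G w c b) z (horVec G z a)
      = ∑ k, z.2 k * (partialDeriv a (christoffel G k c b) z.1
        + ∑ l, christoffel G k a l z.1 * christoffel G l c b z.1) := by
    rw [hG.fderiv_christoffelZero hz]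
    simp only [horVec_fst, horVec_snd, mul_add, Finset.sum_add_distrib]
    congr 1
    simp only [christoffelZero, Finset.sum_mul, Finset.mul_sum]
    rw [Finset.sum_comm]
    congr! 2
    ring
  rw [h i j, h j i, ← Finset.sum_sub_distrib]
  refine Finset.sum_congr rfl fun k _ => ?_
  simp only [curvature, Finset.sum_sub_distrib]
  ring

/-- The horizontal part of the Nijenhuis tensor on the horizontal distribution vanishes. -/
theorem lieBracket_rowJ1_horVec (hG : IsSmoothMetricOn G U) (ha₁ : ContDiffOn ℝ ∞ a₁ (Set.Ioi 0))
    (hb₁ : ContDiffOn ℝ ∞ b₁ (Set.Ioi 0)) {z : Phase n} (hz : z ∈ puncturedPhase U)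
    (i j : Fin n) :
    VectorField.lieBracket ℝ (fun w => rowJ1 G a₁ b₁ w i) (fun w => horVec G w j) z
      + VectorField.lieBracket ℝ (fun w => horVec G w i) (fun w => rowJ1 G a₁ b₁ w j) z = 0 := by
  have hrow (w : Phase n) (k : Fin n) :
      rowJ1 G a₁ b₁ w k = 0 + ∑ h, J1 G a₁ b₁ w k h • vertVec h := by rw [rowJ1, zero_add]
  have hdΓ := hG.differentiableAt_christoffelZero hz
  have hdJ := hG.differentiableAt_J1 ha₁ hb₁ hz
  have h1 := lieBracket_sum_smul_vertVec (hdJ i) (hdΓ j) 0 (stdVec j, 0)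
  have h2 := lieBracket_sum_smul_vertVec (hdΓ i) (hdJ j) (stdVec i, 0) 0
  simp only [← hrow] at h1 h2
  change VectorField.lieBracket ℝ (fun w => rowJ1 G a₁ b₁ w i) (fun w => horVec G w j) z
    = ∑ h, (fderiv ℝ (fun w => christoffelZero G w j h) z (rowJ1 G a₁ b₁ z i)
      - fderiv ℝ (fun w => J1 G a₁ b₁ w i h) z (horVec G z j)) • vertVec h at h1
  change VectorField.lieBracket ℝ (fun w => horVec G w i) (fun w => rowJ1 G a₁ b₁ w j) z
    = ∑ h, (fderiv ℝ (fun w => J1 G a₁ b₁ w j h) z (horVec G z i)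
      - fderiv ℝ (fun w => christoffelZero G w i h) z (rowJ1 G a₁ b₁ z j)) • vertVec h at h2
  rw [h1, h2, ← Finset.sum_add_distrib]
  refine Finset.sum_eq_zero fun b _ => ?_
  rw [← add_smul]
  have hΓ (a c : Fin n) : fderiv ℝ (fun w => christoffelZero G w c b) z (rowJ1 G a₁ b₁ z a)
      = a₁ (energy G z) * loweredChristoffel G a c b z.1
        + b₁ (energy G z) * z.2 a * christoffelZero G z c b := by
    rw [hG.fderiv_christoffelZero hz]
    simp only [rowJ1_fst, rowJ1_snd, map_zero, mul_zero, zero_add, J1, add_mul,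
      Finset.sum_add_distrib, loweredChristoffel, christoffelZero, Finset.mul_sum, mul_assoc]
  have hJ1 (a c : Fin n) : fderiv ℝ (fun w => J1 G a₁ b₁ w c b) z (horVec G z a)
      = a₁ (energy G z) * (loweredChristoffel G b a c z.1 + loweredChristoffel G c a b z.1)
        + b₁ (energy G z) * (christoffelZero G z a c * z.2 b + z.2 c * christoffelZero G z a b) := by
    rw [hG.fderiv_J1 ha₁ hb₁ hz, hG.fderiv_energy_horVec hz, horVec_fst, horVec_snd, horVec_snd,
      ← hG.partialDeriv_eq_loweredChristoffel hz.1]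
    simp only [partialDeriv]
    ring
  -- The two brackets have components `-(a₁ Γ_bji + b₁ Γ⁰ⱼᵢ p_b)` and `a₁ Γ_bij + b₁ Γ⁰ᵢⱼ p_b`,
  -- which cancel by symmetry in `i`, `j`.
  rw [hΓ, hΓ, hJ1, hJ1, hG.christoffelZero_symm hz j i, hG.loweredChristoffel_symm hz.1 b j i]
  rw [show ∀ r : ℝ, r = 0 → r • (vertVec b : Phase n) = 0 by rintro _ rfl; simp]
  ring

theorem lieBracket_rowJ1 (hG : IsSmoothMetricOn G U) (ha₁ : ContDiffOn ℝ ∞ a₁ (Set.Ioi 0))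
    (hb₁ : ContDiffOn ℝ ∞ b₁ (Set.Ioi 0)) {A : ℝ} (ha : ∀ t : ℝ, 0 < t → a₁ t = A * √t)
    {z : Phase n} (hz : z ∈ puncturedPhase U) (i j : Fin n) :
    VectorField.lieBracket ℝ (fun w => rowJ1 G a₁ b₁ w i) (fun w => rowJ1 G a₁ b₁ w j) z
      = ∑ b, (A ^ 2 / 2 * (z.2 i * G z.1 j b - z.2 j * G z.1 i b)) • vertVec b := by
  have hrow (w : Phase n) (k : Fin n) :
      rowJ1 G a₁ b₁ w k = 0 + ∑ h, J1 G a₁ b₁ w k h • vertVec h := by rw [rowJ1, zero_add]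
  have hdJ := hG.differentiableAt_J1 ha₁ hb₁ hz
  have h1 := lieBracket_sum_smul_vertVec (hdJ i) (hdJ j) 0 0
  simp only [← hrow] at h1
  rw [h1]
  refine Finset.sum_congr rfl fun b _ => ?_
  congr 1
  set t := energy G z with ht
  have ht0 : 0 < t := hG.energy_pos hz
  have hs : √t ≠ 0 := (Real.sqrt_pos.2 ht0).ne'
  have hda : deriv a₁ t = A * (1 / (2 * √t)) := by
    have h := (Real.hasDerivAt_sqrt ht0.ne').const_mul A
    refine (h.congr_of_eventuallyEq ?_).deriv
    filter_upwards [isOpen_Ioi.mem_nhds ht0] with s hs using ha s hs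
  -- Writing `t = s²` with `s = √t` makes `a₁`, `a₁'` and `t` rational in `s`.
  have hsq : t = √t ^ 2 := (Real.sq_sqrt ht0.le).symm
  rw [hG.fderiv_J1 ha₁ hb₁ hz, hG.fderiv_J1 ha₁ hb₁ hz, hG.fderiv_energy_rowJ1 hz,
    hG.fderiv_energy_rowJ1 hz]
  simp only [rowJ1_fst, rowJ1_snd, J1, map_zero, ← ht, hda, ha t ht0]
  rw [hG.symm hz.1 j i]
  generalize deriv b₁ t = b'
  generalize b₁ t = β
  generalize √t = s at *
  rw [hsq]
  field_simp
  ring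

/-- The mixed brackets cancel by linearity before `J` is evaluated on them, so `a₂` and `b₂` never
enter. -/
theorem nijenhuis_horVec (hG : IsSmoothMetricOn G U) (ha₁ : ContDiffOn ℝ ∞ a₁ (Set.Ioi 0))
    (hb₁ : ContDiffOn ℝ ∞ b₁ (Set.Ioi 0)) {A : ℝ} (ha : ∀ t : ℝ, 0 < t → a₁ t = A * √t)
    {z : Phase n} (hz : z ∈ puncturedPhase U) (i j : Fin n) :
    nijenhuis (diagJ G a₁ a₂ b₁ b₂) (fun w => horVec G w i) (fun w => horVec G w j) z
      = ∑ b, (A ^ 2 / 2 * (z.2 i * G z.1 j b - z.2 j * G z.1 i b)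
        - ∑ k, z.2 k * curvature G k b i j z.1) • vertVec b := by
  have hJ (w : Phase n) (k : Fin n) : diagJ G a₁ a₂ b₁ b₂ w (horVec G w k) = rowJ1 G a₁ b₁ w k :=
    diagJ_horVec G a₁ a₂ b₁ b₂ w k
  have hmix : diagJ G a₁ a₂ b₁ b₂ z
        (VectorField.lieBracket ℝ (fun w => rowJ1 G a₁ b₁ w i) (fun w => horVec G w j) z)
      + diagJ G a₁ a₂ b₁ b₂ z
        (VectorField.lieBracket ℝ (fun w => horVec G w i) (fun w => rowJ1 G a₁ b₁ w j) z) = 0 := by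
    rw [← diagJL_apply, ← diagJL_apply, ← map_add, hG.lieBracket_rowJ1_horVec ha₁ hb₁ hz, map_zero]
  simp only [nijenhuis, hJ]
  rw [eq_neg_of_add_eq_zero_left hmix, sub_neg_eq_add, add_sub_cancel_right,
    hG.lieBracket_rowJ1 ha₁ hb₁ ha hz, hG.lieBracket_horVec hz, ← Finset.sum_sub_distrib]
  simp only [sub_smul]

theorem nijenhuis_horVec_eq_zero_iff (hG : IsSmoothMetricOn G U)
    (ha₁ : ContDiffOn ℝ ∞ a₁ (Set.Ioi 0))
    (hb₁ : ContDiffOn ℝ ∞ b₁ (Set.Ioi 0)) {A : ℝ} (ha : ∀ t : ℝ, 0 < t → a₁ t = A * √t)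
    {z : Phase n} (hz : z ∈ puncturedPhase U) (i j : Fin n) :
    nijenhuis (diagJ G a₁ a₂ b₁ b₂) (fun w => horVec G w i) (fun w => horVec G w j) z = 0 ↔
      ∀ b, ∑ k, z.2 k * curvature G k b i j z.1
        = A ^ 2 / 2 * (z.2 i * G z.1 j b - z.2 j * G z.1 i b) := by
  rw [hG.nijenhuis_horVec ha₁ hb₁ ha hz, sum_smul_vertVec]
  constructor
  · intro h b
    have := congrArg (fun X : Phase n => X.2 b) h
    simp only [Prod.snd_zero, PiLp.zero_apply] at this
    linarith
  · intro h
    refine Prod.ext rfl ?_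
    ext b
    simp [h b]

/-- Over a coordinate domain, the Nijenhuis tensor vanishes if and only if the sectional curvature
equals `A² / 2`. -/
theorem nijenhuis_eq_zero_iff (hG : IsSmoothMetricOn G U) (ha₁ : ContDiffOn ℝ ∞ a₁ (Set.Ioi 0))
    (ha₂ : ContDiffOn ℝ ∞ a₂ (Set.Ioi 0)) (hb₁ : ContDiffOn ℝ ∞ b₁ (Set.Ioi 0))
    (hb₂ : ContDiffOn ℝ ∞ b₂ (Set.Ioi 0)) {A : ℝ} (ha : ∀ t : ℝ, 0 < t → a₁ t = A * √t)
    (hsq : ∀ z ∈ puncturedPhase U, ∀ X,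
      diagJ G a₁ a₂ b₁ b₂ z (diagJ G a₁ a₂ b₁ b₂ z X) = -X) :
    (∀ X Y : Phase n → Phase n, ContDiffOn ℝ ∞ X (puncturedPhase U) →
      ContDiffOn ℝ ∞ Y (puncturedPhase U) → ∀ z ∈ puncturedPhase U,
        nijenhuis (diagJ G a₁ a₂ b₁ b₂) X Y z = 0) ↔
      ∀ q ∈ U, ∀ u v, LinearIndependent ℝ ![u, v] → sectionalCurvature G q u v = A ^ 2 / 2 := by
  have hopen := isOpen_puncturedPhase hG.isOpen
  constructor
  · intro h q hq
    rw [hG.sectionalCurvature_eq_iff hq, hG.loweredCurvature_eq_iff hq]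
    intro p hp b i j
    have hz : ((q, p) : Phase n) ∈ puncturedPhase U := ⟨hq, hp⟩
    exact (hG.nijenhuis_horVec_eq_zero_iff ha₁ hb₁ ha hz i j).1
      (h _ _ (hG.contDiffOn_horVec i) (hG.contDiffOn_horVec j) _ hz) b
  · intro h X Y hX hY z hz
    have hdiff {V : Phase n → Phase n} (hV : ContDiffOn ℝ ∞ V (puncturedPhase U)) :
        DifferentiableAt ℝ V z :=
      (hV.contDiffAt (hopen.mem_nhds hz)).differentiableAt (by simp)
    have hL := hG.differentiableAt_diagJL ha₁ ha₂ hb₁ hb₂ hz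
    have hN {V W : Phase n → Phase n} (hV : ContDiffOn ℝ ∞ V (puncturedPhase U))
        (hW : ContDiffOn ℝ ∞ W (puncturedPhase U)) :
        nijenhuis (diagJ G a₁ a₂ b₁ b₂) V W z
          = nijenhuisTensor (diagJL G a₁ a₂ b₁ b₂) z (V z) (W z) :=
      nijenhuis_eq_nijenhuisTensor hL (hsq z hz) (hdiff hV) (hdiff hW)
    -- Tensoriality reduces arbitrary fields to their values at `z`, and the span argument reduces
    -- these to the horizontal frame.
    rw [hN hX hY, nijenhuisTensor_eq_zero_of_span (h := horVec G z) hL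
      (Filter.eventually_of_mem (hopen.mem_nhds hz) hsq)
      (exists_eq_horizontal_add_map a₁ a₂ b₁ b₂ (hsq z hz)) fun i j => ?_]
    · rfl
    · rw [← hN (hG.contDiffOn_horVec i) (hG.contDiffOn_horVec j),
        hG.nijenhuis_horVec_eq_zero_iff ha₁ hb₁ ha hz]
      have hc := (hG.loweredCurvature_eq_iff hz.1 _).1
        ((hG.sectionalCurvature_eq_iff hz.1 _).1 (h z.1 hz.1))
      exact fun b => hc z.2 hz.2 b i j

end IsSmoothMetricOn

end Integrability

end CotangentACS

/-! ### From the charts to the manifold, and the bound on `b₁`. -/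

theorem theorem4 {n : ℕ} {M : Type*} [TopologicalSpace M]
    [ChartedSpace (EuclideanSpace ℝ (Fin n)) M] [IsManifold (𝓡 n) ∞ M]
    (g : Bundle.ContMDiffRiemannianMetric (𝓡 n) ∞ (EuclideanSpace ℝ (Fin n))
      fun x : M => TangentSpace (𝓡 n) x)
    (a₁ a₂ b₁ b₂ : ℝ → ℝ)
    (ha₁ : ContDiffOn ℝ ∞ a₁ (Set.Ioi 0)) (ha₂ : ContDiffOn ℝ ∞ a₂ (Set.Ioi 0))
    (hb₁ : ContDiffOn ℝ ∞ b₁ (Set.Ioi 0)) (hb₂ : ContDiffOn ℝ ∞ b₂ (Set.Ioi 0))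
    (A : ℝ) (hA : 0 < A) (ha : ∀ t : ℝ, 0 < t → a₁ t = A * √t)
    (hJ : CotangentACS.IsAlmostComplex g a₁ a₂ b₁ b₂)
    (hpos : ∀ t : ℝ, 0 < t → 0 < A + 2 * √t * b₁ t) :
    (CotangentACS.IsIntegrable g a₁ a₂ b₁ b₂ ↔
      ∃ c : ℝ, 0 < c ∧ CotangentACS.HasConstantSectionalCurvature g c ∧ A = √(2 * c)) ∧
    (∀ c : ℝ, 0 < c → CotangentACS.HasConstantSectionalCurvature g c → A = √(2 * c) →
      ∀ t : ℝ, 0 < t → -√(c / (2 * t)) < b₁ t) := by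
  -- Since `A = √(2c)` forces `c = A²/2`, the existential statement concerns this single value,
  -- including when `n ≤ 1` and the curvature condition is vacuous.
  have hiff : CotangentACS.IsIntegrable g a₁ a₂ b₁ b₂ ↔
      CotangentACS.HasConstantSectionalCurvature g (A ^ 2 / 2) := by
    refine forall₂_congr fun φ hφ => ?_
    have hG : CotangentACS.IsSmoothMetricOn (CotangentACS.metricMatrix g φ) φ.target :=
      ⟨φ.open_target, CotangentACS.contDiffOn_metricMatrix g hφ,
        CotangentACS.posDef_metricMatrix g hφ⟩
    -- The induced chart is onto the punctured phase space, so conditions on covectors become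
    -- conditions on coordinates.
    have hsurj (P : CotangentACS.Phase n → Prop) :
        (∀ p : CotangentACS.NonzeroCotangent n M, p.base ∈ φ.source →
          P (CotangentACS.inducedChart φ p)) ↔ ∀ z ∈ CotangentACS.puncturedPhase φ.target, P z := by
      refine ⟨fun h z hz => ?_, fun h p hp =>
        h _ (CotangentACS.inducedChart_mem_inducedTarget hφ p hp)⟩
      obtain ⟨p, hp, rfl⟩ := CotangentACS.exists_inducedChart_eq hφ hz
      exact h p hp
    rw [← hG.nijenhuis_eq_zero_iff ha₁ ha₂ hb₁ hb₂ ha ((hsurj _).1 (hJ φ hφ))]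
    exact forall₂_congr fun X Y => imp_congr_right fun _ => imp_congr_right fun _ =>
      hsurj fun z => CotangentACS.nijenhuis (CotangentACS.naturalJ g a₁ a₂ b₁ b₂ φ) X Y z = 0
  refine ⟨hiff.trans ⟨fun h => ⟨A ^ 2 / 2, by positivity, h, ?_⟩, ?_⟩, ?_⟩
  · rw [mul_div_cancel₀ _ two_ne_zero, Real.sqrt_sq hA.le]
  · rintro ⟨c, hc, h, rfl⟩
    rwa [Real.sq_sqrt (by positivity), mul_div_cancel_left₀ _ two_ne_zero]
  · rintro c hc - rfl t ht
    have hs : 0 < √t := Real.sqrt_pos.2 ht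
    -- This factorization turns the positivity hypothesis into `2√t (√(c/(2t)) + b₁(t)) > 0`.
    have h1 : √(c / (2 * t)) * (2 * √t) = √(2 * c) := by
      rw [← Real.sqrt_sq (zero_le_two (α := ℝ)), ← Real.sqrt_mul (by positivity),
        ← Real.sqrt_mul (by positivity)]
      congr 1
      rw [Real.sqrt_sq zero_le_two]
      field_simp
    have h2 := hpos t ht
    rw [← h1] at h2
    nlinarith
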